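/- Let $k$ be an algebraically closed field (for example $k=\mathbb{C}$), let $\mathbb{P}^2=\mathrm{Proj}\,k[X,Y,Z]$, and let $s$ be a nonzero global section of the tangent bundle $T_{\mathbb{P}^2}=\mathcal{D}er_k(\mathcal{O}_{\mathbb{P}^2},\mathcal{O}_{\mathbb{P}^2})$. Let $V\subset\mathbb{P}^2$ be the scheme of zeros of $s$, that is, the closed subscheme whose ideal sheaf $\mathcal{I}_V$ is generated by the local components of $s$ (equivalently, by the local functions $s(a)$, where $a$ runs over local sections of $\mathcal{O}_{\mathbb{P}^2}$). Then $V$ is of one of the following types: (a) $V$ consists of three distinct points, each of multiplicity one; (b) $V$ consists of two distinct points, one of multiplicity two and the other of multiplicity one; (c) $V$ consists of a single point of multiplicity three; (d) $V$ is the (scheme-theoretic) union of a line and a reduced closed point not on the line; (e) $V$ is a line with an embedded point on it: there are a line $L$ and a closed point $p\in L$ such that $V$ contains $L$ as a closed subscheme, $V$ and $L$ agree on $\mathbb{P}^2\setminus\{p\}$, $p$ is an embedded point of $V$, and this embedded point is simple, i.e. the kernel $\mathcal{I}_L/\mathcal{I}_V$ of $\mathcal{O}_V\to\mathcal{O}_L$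 has length one. Here the multiplicity of $V$ at a point $x$ in (a)-(c) is the length of the local ring $\mathcal{O}_{V,x}$, a line is the reduced closed subscheme $\ell=0$ for a nonzero linear form $\ell$, and an embedded point of $V$ is a point $x$ such that the maximal ideal of $\mathcal{O}_{V,x}$ is an associated prime, but not a minimal prime, of $\mathcal{O}_{V,x}$. -/

import Mathlib

open CategoryTheory AlgebraicGeometry TopologicalSpace

universe u

noncomputable section

namespace PlaneTangent

/-! ### Sections of the tangent sheaf and their zero schemes -/

/-- The constants in `Γ(X, U)`, for a scheme `X` over a field `k` with structure map `f`. -/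
def constants {k : Type u} [Field k] {X : Scheme.{u}} (f : X ⟶ Spec (CommRingCat.of k))
    (U : X.Opens) : k →+* Γ(X, U) :=
  ((Scheme.ΓSpecIso (CommRingCat.of k)).inv ≫ f.appTop ≫
    X.presheaf.map (homOfLE (le_top : U ≤ ⊤)).op).hom

/-- A global section of the tangent sheaf `T_X = Hom(Ω_{X/k}, 𝒪_X) = Der_k(𝒪_X, 𝒪_X)` of a
`k`-scheme `X`: a `k`-linear derivation of the sheaf `𝒪_X`, that is, a family of derivations of
the rings `Γ(X, U)` that is compatible with restriction. (An additive derivation is `k`-linear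
iff it kills the constants.) -/
@[ext]
structure TangentSection {k : Type u} [Field k] {X : Scheme.{u}}
    (f : X ⟶ Spec (CommRingCat.of k)) where
  der : ∀ U : X.Opens, Derivation ℤ Γ(X, U) Γ(X, U)
  der_constants : ∀ (U : X.Opens) (c : k), der U (constants f U c) = 0
  der_restrict : ∀ (U V : X.Opens) (h : V ≤ U) (a : Γ(X, U)),
    der V ((X.presheaf.map (homOfLE h).op).hom a) =
      (X.presheaf.map (homOfLE h).op).hom (der U a)

namespace TangentSection

variable {k : Type u} [Field k] {X : Scheme.{u}} {f : X ⟶ Spec (CommRingCat.of k)}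

instance : Zero (TangentSection f) where
  zero :=
    { der := fun _ => 0
      der_constants := fun _ _ => rfl
      der_restrict := fun _ _ _ _ => by simp }

theorem map_span_range_der (s : TangentSection f) (U : X.Opens) (hU : IsAffineOpen U)
    (g : Γ(X, U)) :
    (Ideal.span (Set.range (s.der U))).map
        (X.presheaf.map (homOfLE (X.basicOpen_le g)).op).hom =
      Ideal.span (Set.range (s.der (X.basicOpen g))) := by
  let F := X.presheaf.map (homOfLE (X.basicOpen_le g)).op
  apply le_antisymm
  · rw [Ideal.map_le_iff_le_comap, Ideal.span_le]
    rintro _ ⟨a, rfl⟩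
    exact Ideal.subset_span ⟨F.hom a, s.der_restrict _ _ (X.basicOpen_le g) a⟩
  · rw [Ideal.span_le]
    rintro _ ⟨b, rfl⟩
    let : Algebra Γ(X, U) Γ(X, X.basicOpen g) := F.hom.toAlgebra
    have : IsLocalization.Away g Γ(X, X.basicOpen g) :=
      hU.isLocalization_of_eq_basicOpen _ _ rfl
    have key : ∀ a, s.der (X.basicOpen g) (F.hom a) ∈
        (Ideal.span (Set.range (s.der U))).map F.hom := fun a => by
      rw [s.der_restrict _ _ (X.basicOpen_le g) a]
      exact Ideal.mem_map_of_mem _ (Ideal.subset_span ⟨a, rfl⟩)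
    obtain ⟨⟨a, ⟨_, n, rfl⟩⟩, hb⟩ := IsLocalization.surj (Submonoid.powers g) b
    have hb' : b * F.hom (g ^ n) = F.hom a := hb
    have hu : IsUnit (F.hom (g ^ n)) :=
      IsLocalization.map_units Γ(X, X.basicOpen g) (⟨g ^ n, n, rfl⟩ : Submonoid.powers g)
    have h1 := congrArg (s.der (X.basicOpen g)) hb'
    rw [Derivation.leibniz, smul_eq_mul, smul_eq_mul] at h1
    refine (Ideal.unit_mul_mem_iff_mem _ hu).mp ?_
    rw [eq_sub_of_add_eq' h1]
    exact sub_mem (key a) (Ideal.mul_mem_left _ _ (key _))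

/-- The ideal sheaf of the zero scheme of a section `s` of `T_X`: the image of the map
`Ω_{X/k} ⟶ 𝒪_X` that `s` is, i.e. on each affine open `U` the ideal generated by all `s(a)`,
`a ∈ Γ(X, U)`. Where `T_X` is free with basis dual to `dx₁, …, dxₙ`, it is generated by the
components `s(x₁), …, s(xₙ)` of `s`. -/
def zeroIdeal (s : TangentSection f) : X.IdealSheafData where
  ideal U := Ideal.span (Set.range (s.der U.1))
  map_ideal_basicOpen U g := s.map_span_range_der U.1 U.2 g

/-- The zero scheme of a section of the tangent sheaf. -/
def zeroScheme (s : TangentSection f) : Scheme.{u} := s.zeroIdeal.subscheme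

end TangentSection

/-! ### The projective plane -/

section Plane

variable (k : Type u) [Field k]

/-- The grading of `k[X, Y, Z]` by degree. -/
abbrev grading : ℕ → Submodule k (MvPolynomial (Fin 3) k) :=
  MvPolynomial.homogeneousSubmodule (Fin 3) k

instance : GradedAlgebra (grading k) := MvPolynomial.gradedAlgebra

/-- The projective plane `Proj k[X, Y, Z]`. -/
abbrev Plane : Scheme.{u} := Proj (grading k)

/-- The structure map of the projective plane. -/
def planeToSpec : Plane k ⟶ Spec (CommRingCat.of k) :=
  Proj.toSpecZero (grading k) ≫ Spec.map (CommRingCat.ofHom (algebraMap k (grading k 0)))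

variable {k}

/-- The closed set `ℓ = 0` in the plane. -/
def zeroSet (l : MvPolynomial (Fin 3) k) : Closeds (Plane k) :=
  ⟨ProjectiveSpectrum.zeroLocus (grading k) {l},
    ProjectiveSpectrum.isClosed_zeroLocus (grading k) {l}⟩

/-- Lines in the plane, as closed sets: the sets `ℓ = 0` with `ℓ` a nonzero linear form. -/
def IsLine (L : Closeds (Plane k)) : Prop :=
  ∃ l : MvPolynomial (Fin 3) k, l.IsHomogeneous 1 ∧ l ≠ 0 ∧ L = zeroSet l

end Plane

/-! ### The five types -/

/-- The multiplicity of a zero-dimensional scheme at a point: the length of its local ring. -/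
def multiplicity (Z : Scheme.{u}) (x : Z) : ℕ∞ :=
  Module.length (Z.presheaf.stalk x) (Z.presheaf.stalk x)

/-- An embedded point: the maximal ideal of the local ring is an associated prime of that ring
but not a minimal one. -/
def IsEmbeddedPoint (Z : Scheme.{u}) (x : Z) : Prop :=
  IsLocalRing.maximalIdeal (Z.presheaf.stalk x) ∈
      associatedPrimes (Z.presheaf.stalk x) (Z.presheaf.stalk x) ∧
    IsLocalRing.maximalIdeal (Z.presheaf.stalk x) ∉ minimalPrimes (Z.presheaf.stalk x)

/-- Three distinct (reduced) points. -/
def IsThreePoints (Z : Scheme.{u}) : Prop :=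
  ∃ p q r : Z, p ≠ q ∧ p ≠ r ∧ q ≠ r ∧ (∀ x : Z, x = p ∨ x = q ∨ x = r) ∧
    multiplicity Z p = 1 ∧ multiplicity Z q = 1 ∧ multiplicity Z r = 1

/-- Two points, one of multiplicity two and the other of multiplicity one. -/
def IsDoubleAndSimplePoint (Z : Scheme.{u}) : Prop :=
  ∃ p q : Z, p ≠ q ∧ (∀ x : Z, x = p ∨ x = q) ∧ multiplicity Z p = 2 ∧ multiplicity Z q = 1

/-- A single point of multiplicity three. -/
def IsTriplePoint (Z : Scheme.{u}) : Prop :=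
  ∃ p : Z, (∀ x : Z, x = p) ∧ multiplicity Z p = 3

section Types

variable {k : Type u} [Field k]

/-- The closed subscheme of the plane with ideal sheaf `I` is the union of a line and a (reduced)
closed point not on the line. -/
def IsLineUnionPoint (I : (Plane k).IdealSheafData) : Prop :=
  ∃ (L : Closeds (Plane k)) (p : Plane k) (hp : IsClosed ({p} : Set (Plane k))),
    IsLine L ∧ p ∉ L ∧
      I = Scheme.IdealSheafData.vanishingIdeal L ⊓
        Scheme.IdealSheafData.vanishingIdeal ⟨{p}, hp⟩

/-- The closed subscheme `V` of the plane with ideal sheaf `I` is a line `L` with an embedded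
point `p` on it: `V` contains `L` and agrees with it away from the closed point `p ∈ L`,
`p` is an embedded point of `V`, and it is a simple one, that is, the kernel `I_L / I` of
`𝒪_V ⟶ 𝒪_L`, which is supported at `p`, has length one. -/
def IsLineWithEmbeddedPoint (I : (Plane k).IdealSheafData) : Prop :=
  ∃ (L : Closeds (Plane k)) (p : Plane k),
    IsLine L ∧ IsClosed ({p} : Set (Plane k)) ∧ p ∈ L ∧
      I ≤ Scheme.IdealSheafData.vanishingIdeal L ∧
      (∀ U : (Plane k).affineOpens, p ∉ U.1 →
        I.ideal U = (Scheme.IdealSheafData.vanishingIdeal L).ideal U) ∧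
      (∃ x : I.subscheme, I.subschemeι x = p ∧ IsEmbeddedPoint I.subscheme x) ∧
      (∀ U : (Plane k).affineOpens, p ∈ U.1 →
        Module.length Γ(Plane k, U)
          ((Scheme.IdealSheafData.vanishingIdeal L).ideal U ⧸
            (I.ideal U).submoduleOf ((Scheme.IdealSheafData.vanishingIdeal L).ideal U)) = 1)

end Types

end PlaneTangent

end

/-!
By the Euler sequence, a global section of the tangent bundle is an endomorphism `T` of the
three-dimensional space of linear forms, up to scalars. On the chart `b n ≠ 0` of a basis `b` it
sends the coordinate `b m / b n` to the dehomogenization of `T (b m) - (b m / b n) T (b n)`.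
Nonzero sections correspond to non-scalar `T`, and these fall into two classes.

If `T` has a cyclic vector, take the basis `b₀`, `T b₀`, `T² b₀`. All zeros lie in the chart
`b₀ ≠ 0`, where in the coordinates `t = b₁ / b₀` and `v = b₂ / b₀` they satisfy `v = t²` and
`χ(t) = 0` for the cubic `χ` of the companion matrix. So `V` is the spectrum of `k[t] / (χ)`, and
the multiplicities of its points are those of the roots of `χ`.

Otherwise `T` is a scalar plus an endomorphism `m ↦ φ(m) ℓ` of rank one, and the ideal sheaf of `V`
is `I_L I_p`, where `L` is the line `ℓ = 0` and `p` is the common zero of the forms in `ker φ`.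
If `p ∉ L`, this product is an intersection; if `p ∈ L`, then `I_L / I_L I_p ≅ 𝒪 / I_p` has length
one.
-/

noncomputable section

namespace PlaneTangent

section EndomorphismDichotomy

open Polynomial

variable {k V : Type*} [Field k] [AddCommGroup V] [Module k V] {T : Module.End k V}

variable (T) in
theorem exists_forall_aeval_apply_eq_zero_iff [FiniteDimensional k V] :
    ∃ v : V, ∀ p : k[X], aeval T p v = 0 ↔ aeval T p = 0 := by
  obtain ⟨v, hv⟩ := Module.exists_ker_toSpanSingleton_eq_annihilator k[X] (Module.AEval' T)
  obtain ⟨v, rfl⟩ := (Module.AEval'.of T).surjective v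
  refine ⟨v, fun p => ?_⟩
  have hp : p • Module.AEval'.of T v = 0 ↔ aeval T p v = 0 := by
    rw [← Module.AEval.of_aeval_smul, LinearEquiv.map_eq_zero_iff, Module.End.smul_def]
  rw [← hp, ← LinearMap.toSpanSingleton_apply, ← LinearMap.mem_ker, hv,
    Module.AEval.annihilator_eq_ker_aeval, RingHom.mem_ker]

variable (T) in
theorem exists_linearIndependent_pow_apply [FiniteDimensional k V] :
    ∃ v : V, LinearIndependent k fun i : Fin (minpoly k T).natDegree => (T ^ (i : ℕ)) v := by
  obtain ⟨v, hv⟩ := exists_forall_aeval_apply_eq_zero_iff T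
  refine ⟨v, Fintype.linearIndependent_iff.mpr fun g hg => ?_⟩
  have hp := (hv (∑ i, C (g i) * X ^ (i : ℕ))).mp (by simpa [Algebra.smul_def] using hg)
  exact Fintype.linearIndependent_iff.mp (linearIndependent_pow T) g
    (by simpa [Algebra.smul_def] using hp)

theorem natDegree_minpoly_le_finrank [FiniteDimensional k V] :
    (minpoly k T).natDegree ≤ Module.finrank k V := by
  rw [← T.charpoly_natDegree]
  exact natDegree_le_of_dvd (LinearMap.minpoly_dvd_charpoly T) T.charpoly_monic.ne_zero

theorem exists_cyclic_basis (hV : Module.finrank k V = 3) (hT : (minpoly k T).natDegree = 3) :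
    ∃ b : Module.Basis (Fin 3) k V, T (b 0) = b 1 ∧ T (b 1) = b 2 := by
  have : FiniteDimensional k V := Module.finite_of_finrank_pos (by omega)
  obtain ⟨v, hv⟩ := exists_linearIndependent_pow_apply T
  rw [hT] at hv
  let b := basisOfLinearIndependentOfCardEqFinrank hv (by simp [hV])
  have hb : ∀ i, b i = (T ^ (i : ℕ)) v := by simp [b]
  exact ⟨b, by simp [hb], by simp [hb, pow_succ]⟩

theorem exists_sub_mul_sub_eq_zero [IsAlgClosed k] [FiniteDimensional k V]
    (hT : (minpoly k T).natDegree = 2) :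
    ∃ x y : k, (T - algebraMap k _ x) * (T - algebraMap k _ y) = 0 := by
  have hs := IsAlgClosed.splits (minpoly k T)
  obtain ⟨x, y, hxy⟩ := Multiset.card_eq_two.mp (hs.natDegree_eq_card_roots.symm.trans hT)
  have h := congr(aeval T $(hs.eq_prod_roots_of_monic (minpoly.monic (IsIntegral.of_finite k T))))
  exact ⟨x, y, by simpa [hxy] using h.symm⟩

theorem exists_finrank_range_sub_eq_one [IsAlgClosed k] (hV : Module.finrank k V = 3)
    (hT : ∀ x : k, T ≠ algebraMap k _ x) (hdeg : (minpoly k T).natDegree ≠ 3) :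
    ∃ x : k, Module.finrank k (LinearMap.range (T - algebraMap k _ x)) = 1 := by
  have : FiniteDimensional k V := Module.finite_of_finrank_pos (by omega)
  have := nontrivial_of_ne _ _ (hT 0)
  have hlt : 1 < (minpoly k T).natDegree :=
    (minpoly.two_le_natDegree_iff (.of_finite k T)).mpr fun ⟨x, hx⟩ => hT x hx.symm
  have hle := natDegree_minpoly_le_finrank (T := T)
  obtain ⟨x, y, hxy⟩ := exists_sub_mul_sub_eq_zero (T := T) (by omega)
  have hpos : ∀ z : k, 0 < Module.finrank k (LinearMap.range (T - algebraMap k _ z)) := fun z =>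
    Module.finrank_pos_iff.mpr <| (Submodule.nontrivial_iff_ne_bot).mpr fun h =>
      hT z (sub_eq_zero.mp (LinearMap.range_eq_bot.mp h))
  have hker : LinearMap.range (T - algebraMap k _ y) ≤ LinearMap.ker (T - algebraMap k _ x) :=
    LinearMap.range_le_ker_iff.mpr hxy
  have hsum := (T - algebraMap k _ x).finrank_range_add_finrank_ker
  have hmono := Submodule.finrank_mono hker
  have hx := hpos x
  have hy := hpos y
  by_cases h1 : Module.finrank k (LinearMap.range (T - algebraMap k _ x)) = 1
  · exact ⟨x, h1⟩
  · exact ⟨y, by omega⟩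

theorem exists_basis_of_finrank_ker_eq_two {N : Module.End k V} (hV : Module.finrank k V = 3)
    (hN : Module.finrank k (LinearMap.ker N) = 2) {v w : V} (hv : N v ≠ 0) (hw : N w = 0)
    (hw0 : w ≠ 0) :
    ∃ b : Module.Basis (Fin 3) k V, N (b 0) = 0 ∧ b 1 = w ∧ b 2 = v := by
  have : FiniteDimensional k V := Module.finite_of_finrank_pos (by omega)
  obtain ⟨⟨u, hu⟩, huw⟩ := exists_linearIndependent_pair_of_one_lt_finrank
    (R := k) (M := LinearMap.ker N) (x := ⟨w, hw⟩) (by omega) (Subtype.coe_ne_coe.mp hw0)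
  have huw' : LinearIndependent k ![u, w] := by
    have := (LinearIndependent.pair_symm_iff.mp huw).map' (LinearMap.ker N).subtype (by simp)
    convert! this using 1
    ext i
    fin_cases i <;> rfl
  have hspan : Submodule.span k (Set.range ![u, w]) ≤ LinearMap.ker N := by
    rw [Submodule.span_le]
    rintro _ ⟨i, rfl⟩
    fin_cases i <;> assumption
  have hli : LinearIndependent k (Fin.snoc ![u, w] v : Fin 3 → V) :=
    linearIndependent_finSnoc.mpr ⟨huw', fun h => hv (hspan h)⟩
  let b := basisOfLinearIndependentOfCardEqFinrank hli (by simp [hV])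
  have hb : ∀ i, b i = (Fin.snoc ![u, w] v : Fin 3 → V) i := by simp [b]
  exact ⟨b, by simpa [hb, Fin.snoc] using hu, by simp [hb, Fin.snoc], by simp [hb, Fin.snoc]⟩

theorem exists_basis_of_finrank_range_eq_one {N : Module.End k V} (hV : Module.finrank k V = 3)
    (hN : Module.finrank k (LinearMap.range N) = 1) :
    ∃ (b : Module.Basis (Fin 3) k V) (c : k) (i : Fin 3), c ≠ 0 ∧
      N (b 0) = 0 ∧ N (b 1) = 0 ∧ N (b 2) = c • b i := by
  have : FiniteDimensional k V := Module.finite_of_finrank_pos (by omega)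
  have hker : Module.finrank k (LinearMap.ker N) = 2 := by
    have := N.finrank_range_add_finrank_ker
    omega
  obtain ⟨⟨w, v, rfl⟩, hw0, hw⟩ := finrank_eq_one_iff'.mp hN
  replace hw0 : N v ≠ 0 := fun h => hw0 (Subtype.ext h)
  replace hw : ∀ u, ∃ c : k, c • N v = N u := fun u =>
    (hw ⟨N u, u, rfl⟩).imp fun _ => congrArg Subtype.val
  by_cases h : N (N v) = 0
  · obtain ⟨b, h0, h1, h2⟩ := exists_basis_of_finrank_ker_eq_two hV hker hw0 h hw0
    exact ⟨b, 1, 1, one_ne_zero, h0, by rw [h1, h], by rw [h1, h2, one_smul]⟩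
  · obtain ⟨c, hc⟩ := hw (N v)
    have : Nontrivial (LinearMap.ker N) := Module.nontrivial_of_finrank_pos (R := k) (by omega)
    obtain ⟨⟨u, hu⟩, hu0⟩ := exists_ne (0 : LinearMap.ker N)
    obtain ⟨b, h0, h1, h2⟩ :=
      exists_basis_of_finrank_ker_eq_two hV hker h hu (Subtype.coe_ne_coe.mpr hu0)
    exact ⟨b, c, 2, fun hc0 => h (by rw [← hc, hc0, zero_smul]), h0, by rw [h1]; exact hu,
      by rw [h2, hc]⟩

theorem exists_cyclic_basis_or_scalar_add_rank_one [IsAlgClosed k]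
    (hV : Module.finrank k V = 3) (hT : ∀ x : k, T ≠ algebraMap k _ x) :
    (∃ b : Module.Basis (Fin 3) k V, T (b 0) = b 1 ∧ T (b 1) = b 2) ∨
      ∃ (b : Module.Basis (Fin 3) k V) (x c : k) (i : Fin 3), c ≠ 0 ∧
        T (b 0) = x • b 0 ∧ T (b 1) = x • b 1 ∧ T (b 2) = x • b 2 + c • b i := by
  by_cases hdeg : (minpoly k T).natDegree = 3
  · exact .inl (exists_cyclic_basis hV hdeg)
  · obtain ⟨x, hx⟩ := exists_finrank_range_sub_eq_one hV hT hdeg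
    obtain ⟨b, c, i, hc, h0, h1, h2⟩ := exists_basis_of_finrank_range_eq_one hV hx
    simp only [LinearMap.sub_apply, Module.algebraMap_end_apply] at h0 h1 h2
    exact .inr ⟨b, x, c, i, hc, sub_eq_zero.mp h0, sub_eq_zero.mp h1, sub_eq_iff_eq_add'.mp h2⟩

end EndomorphismDichotomy

variable {k : Type u} [Field k]

section RootPoints

open Polynomial

variable {B : Type*} [CommRing B] {π : k[X] →+* B} {f : k[X]}

theorem length_eq_of_ringEquiv {R S : Type*} [CommRing R] [CommRing S] (e : R ≃+* S) :
    Module.length R R = Module.length S S := by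
  apply WithBot.coe_injective
  rw [Module.coe_length, Module.coe_length]
  exact (Order.krullDim_eq_of_orderIso e.idealComapOrderIso).symm

theorem length_quotient_span_X_sub_C_pow (a : k) (n : ℕ) :
    Module.length (k[X] ⧸ Ideal.span {(X - C a) ^ n}) (k[X] ⧸ Ideal.span {(X - C a) ^ n}) = n := by
  rw [← Module.length_eq_of_surjective (S := k[X]) Ideal.Quotient.mk_surjective]
  have h := Ring.ord_pow (mem_nonZeroDivisors_of_ne_zero (X_sub_C_ne_zero a)) n
  rwa [Ring.ord_of_irreducible (irreducible_X_sub_C a), nsmul_one] at h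

theorem comap_eq_span_X_sub_C {P : Ideal B} [P.IsPrime] {a : k} (ha : π (X - C a) ∈ P) :
    P.comap π = Ideal.span {X - C a} :=
  ((PrincipalIdealRing.isMaximal_of_irreducible (irreducible_X_sub_C a)).eq_of_le
    (P.comap_isPrime π).ne_top ((Ideal.span_singleton_le_iff_mem _).mpr ha)).symm

theorem isLocalization_of_surjective {R S : Type*} [CommRing R] [CommRing S] [Algebra R S]
    {M : Submonoid R} (hsurj : Function.Surjective (algebraMap R S))
    (hunit : ∀ y : M, IsUnit (algebraMap R S y)) {g : R} (hg : g ∈ M)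
    (hann : ∀ x, algebraMap R S x = 0 → g * x = 0) : IsLocalization M S := by
  refine (isLocalization_iff M S).mpr ⟨hunit, fun z => ?_, fun {x y} hxy => ⟨⟨g, hg⟩, ?_⟩⟩
  · obtain ⟨x, rfl⟩ := hsurj z
    exact ⟨(x, 1), by simp⟩
  · rw [← sub_eq_zero, ← mul_sub]
    exact hann _ (by rw [map_sub, hxy, sub_self])

theorem length_localization_eq_rootMultiplicity (hπ : Function.Surjective π)
    (hker : RingHom.ker π = Ideal.span {f}) (hf : f ≠ 0) (P : Ideal B) [P.IsPrime] {a : k}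
    (ha : π (X - C a) ∈ P) :
    Module.length (Localization.AtPrime P) (Localization.AtPrime P) = f.rootMultiplicity a := by
  have hP (h : k[X]) : π h ∈ P ↔ X - C a ∣ h := by
    rw [← Ideal.mem_span_singleton, ← comap_eq_span_X_sub_C ha, Ideal.mem_comap]
  obtain ⟨g, hfg, hg⟩ := f.exists_eq_pow_rootMultiplicity_mul_and_not_dvd hf a
  set n := f.rootMultiplicity a
  let J : Ideal k[X] := Ideal.span {(X - C a) ^ n}
  have hle : RingHom.ker π ≤ RingHom.ker (Ideal.Quotient.mk J) := by
    rw [hker, Ideal.mk_ker, Ideal.span_singleton_le_span_singleton, hfg]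
    exact dvd_mul_right _ _
  let ρ : B →+* k[X] ⧸ J := π.liftOfSurjective hπ ⟨Ideal.Quotient.mk J, hle⟩
  have hρ (h : k[X]) : ρ (π h) = Ideal.Quotient.mk J h :=
    π.liftOfSurjective_comp_apply hπ ⟨Ideal.Quotient.mk J, hle⟩ h
  let : Algebra B (k[X] ⧸ J) := ρ.toAlgebra
  have hunit (y : P.primeCompl) : IsUnit (algebraMap B (k[X] ⧸ J) y) := by
    obtain ⟨h, hy⟩ := hπ y.1
    have hcop : IsCoprime ((X - C a) ^ n) h :=
      ((irreducible_X_sub_C a).coprime_iff_not_dvd.mpr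
        ((hP h).not.mp (hy ▸ y.2))).pow_left
    obtain ⟨u, v, huv⟩ := hcop
    refine IsUnit.of_mul_eq_one_right (Ideal.Quotient.mk J v) ?_
    change _ * ρ y.1 = 1
    rw [← hy, hρ, ← map_mul, ← map_one (Ideal.Quotient.mk J), Ideal.Quotient.eq,
      Ideal.mem_span_singleton]
    exact ⟨-u, by linear_combination huv⟩
  have hann (x : B) (hx : algebraMap B (k[X] ⧸ J) x = 0) : π g * x = 0 := by
    obtain ⟨p, rfl⟩ := hπ x
    replace hx : ρ (π p) = 0 := hx
    rw [hρ, Ideal.Quotient.eq_zero_iff_dvd] at hx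
    rw [← map_mul, ← RingHom.mem_ker, hker, Ideal.mem_span_singleton, hfg, mul_comm g]
    exact mul_dvd_mul_right hx g
  have hsurj : Function.Surjective (algebraMap B (k[X] ⧸ J)) := fun z => by
    obtain ⟨h, rfl⟩ := Ideal.Quotient.mk_surjective z
    exact ⟨π h, hρ h⟩
  have := isLocalization_of_surjective hsurj hunit ((hP g).not.mpr hg) hann
  rw [← length_quotient_span_X_sub_C_pow a n]
  exact length_eq_of_ringEquiv (IsLocalization.algEquiv P.primeCompl _ (k[X] ⧸ J)).toRingEquiv

theorem exists_bijective_roots_primeSpectrum [IsAlgClosed k] (hπ : Function.Surjective π)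
    (hker : RingHom.ker π = Ideal.span {f}) (hf : f ≠ 0) :
    ∃ φ : {a // a ∈ f.roots} → PrimeSpectrum B, Function.Bijective φ ∧
      ∀ a, π (X - C a.1) ∈ (φ a).asIdeal := by
  have hprime (a : {a // a ∈ f.roots}) : ((Ideal.span {X - C a.1}).map π).IsPrime := by
    have := PrincipalIdealRing.isMaximal_of_irreducible (irreducible_X_sub_C a.1)
    refine Ideal.map_isPrime_of_surjective hπ ?_
    rw [hker, Ideal.span_singleton_le_span_singleton]
    exact dvd_iff_isRoot.mpr (isRoot_of_mem_roots a.2)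
  have hmem (a : {a // a ∈ f.roots}) : π (X - C a.1) ∈ (Ideal.span {X - C a.1}).map π :=
    Ideal.mem_map_of_mem π (Ideal.mem_span_singleton_self _)
  refine ⟨fun a => ⟨_, hprime a⟩, ⟨fun a b hab => Subtype.ext ?_, fun P => ?_⟩, hmem⟩
  · have := hprime a
    have hb : π (X - C b.1) ∈ (Ideal.span {X - C a.1}).map π :=
      (congrArg PrimeSpectrum.asIdeal hab).ge (hmem b)
    rw [← Ideal.mem_comap, comap_eq_span_X_sub_C (hmem a), Ideal.mem_span_singleton,
      dvd_iff_isRoot, IsRoot, eval_sub, eval_X, eval_C, sub_eq_zero] at hb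
    exact hb
  · have hfP : C f.leadingCoeff * (f.roots.map (X - C ·)).prod ∈ P.asIdeal.comap π := by
      rw [← (IsAlgClosed.splits f).eq_prod_roots, Ideal.mem_comap,
        RingHom.mem_ker.mp (hker ▸ Ideal.mem_span_singleton_self f)]
      exact zero_mem _
    have hP := P.2.comap π
    have hlead : IsUnit (C f.leadingCoeff) :=
      isUnit_C.mpr (isUnit_iff_ne_zero.mpr (leadingCoeff_ne_zero.mpr hf))
    rw [Ideal.unit_mul_mem_iff_mem _ hlead, hP.multiset_prod_mem_iff_exists_mem] at hfP
    obtain ⟨_, hmap, haP⟩ := hfP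
    obtain ⟨a, ha, rfl⟩ := Multiset.mem_map.mp hmap
    refine ⟨⟨a, ha⟩, PrimeSpectrum.ext ?_⟩
    change (Ideal.span {X - C a}).map π = P.asIdeal
    rw [← comap_eq_span_X_sub_C haP]
    exact Ideal.map_comap_of_surjective π hπ P.asIdeal

end RootPoints

open MvPolynomial

section GenericValue

theorem irrelevant_not_le_bot :
    ¬ HomogeneousIdeal.irrelevant (grading k) ≤ (⊥ : HomogeneousIdeal (grading k)) := by
  intro h
  have hX : (X 0 : MvPolynomial (Fin 3) k) ∈ HomogeneousIdeal.irrelevant (grading k) := by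
    rw [HomogeneousIdeal.mem_irrelevant_iff, GradedRing.proj_apply,
      DirectSum.decompose_of_mem_ne (grading k) (isHomogeneous_X k 0) one_ne_zero]
  exact X_ne_zero (R := k) (0 : Fin 3) (h hX)

variable (k) in
/-- The generic point of the projective plane, as a homogeneous prime ideal. -/
def genericPt : ProjectiveSpectrum (grading k) where
  asHomogeneousIdeal := ⊥
  isPrime := Ideal.isPrime_bot (α := MvPolynomial (Fin 3) k)
  not_irrelevant_le := irrelevant_not_le_bot

theorem genericPt_mem {U : (Plane k).Opens} {x : Plane k} (hx : x ∈ U) : genericPt k ∈ U := by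
  have hcl := (ProjectiveSpectrum.le_iff_mem_closure (grading k) (genericPt k) x).mp
    (bot_le (α := HomogeneousIdeal (grading k)))
  obtain ⟨y, hyU, rfl⟩ := mem_closure_iff.mp hcl U.1 U.2 hx
  exact hyU

theorem genericPt_mem_basicOpen {f : MvPolynomial (Fin 3) k} (hf : f ≠ 0) :
    genericPt k ∈ Proj.basicOpen (grading k) f := hf

variable (k) in
/-- The field of fractions of the homogeneous coordinate ring of the plane; it contains the function
field of the plane as its part of degree zero. -/
abbrev Frac : Type u := FractionRing (MvPolynomial (Fin 3) k)

theorem algebraMap_frac_injective :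
    Function.Injective (algebraMap (MvPolynomial (Fin 3) k) (Frac k)) :=
  IsFractionRing.injective _ _

theorem algebraMap_frac_ne_zero {f : MvPolynomial (Fin 3) k} (hf : f ≠ 0) :
    algebraMap (MvPolynomial (Fin 3) k) (Frac k) f ≠ 0 :=
  (map_ne_zero_iff _ algebraMap_frac_injective).mpr hf

theorem primeCompl_genericPt_le :
    (genericPt k).asHomogeneousIdeal.toIdeal.primeCompl ≤
      (nonZeroDivisors (MvPolynomial (Fin 3) k)).comap (RingHom.id _) :=
  fun _ hx => mem_nonZeroDivisors_of_ne_zero hx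

/-- The value at the generic point of a section of `𝒪` over a nonempty open set. -/
def genericValue (U : (Plane k).Opens) (hU : genericPt k ∈ U) : Γ(Plane k, U) →+* Frac k :=
  ((IsLocalization.map (Frac k) (RingHom.id _) (primeCompl_genericPt_le (k := k))).comp
    (algebraMap (HomogeneousLocalization.AtPrime (grading k)
      (genericPt k).asHomogeneousIdeal.toIdeal)
      (Localization (genericPt k).asHomogeneousIdeal.toIdeal.primeCompl))).comp
    (openToLocalization (grading k) U (genericPt k) hU).hom

theorem genericValue_res {U V : (Plane k).Opens} (h : V ≤ U) (hV : genericPt k ∈ V)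
    (a : Γ(Plane k, U)) :
    genericValue V hV (((Plane k).presheaf.map (homOfLE h).op).hom a) =
      genericValue U (h hV) a := rfl

theorem genericValue_mul_of_eq_mk {U : (Plane k).Opens} {hU : genericPt k ∈ U} {a : Γ(Plane k, U)}
    {c : HomogeneousLocalization.NumDenSameDeg (grading k)
      (genericPt k).asHomogeneousIdeal.toIdeal.primeCompl}
    (h : a.1 ⟨genericPt k, hU⟩ = .mk c) :
    genericValue U hU a * algebraMap _ _ (c.den : MvPolynomial (Fin 3) k) =
      algebraMap _ (Frac k) (c.num : MvPolynomial (Fin 3) k) := by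
  change IsLocalization.map (Frac k) (RingHom.id _) (primeCompl_genericPt_le (k := k))
    (HomogeneousLocalization.val (a.1 ⟨genericPt k, hU⟩)) * _ = _
  rw [h, HomogeneousLocalization.val_mk, Localization.mk_eq_mk', IsLocalization.map_mk']
  exact IsLocalization.mk'_spec _ _ _

theorem genericValue_injective (U : (Plane k).Opens) (hU : genericPt k ∈ U) :
    Function.Injective (genericValue U hU) := by
  rw [injective_iff_map_eq_zero]
  intro a ha
  refine Proj.ext _ _ _ (funext fun x => ?_)
  obtain ⟨V, hxV, i, d, r, t, hnin, hfrac⟩ := a.2 x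
  have hr := genericValue_mul_of_eq_mk (hU := hU) (a := a) (hfrac ⟨_, genericPt_mem hxV⟩)
  rw [ha, zero_mul, eq_comm, map_eq_zero_iff _ algebraMap_frac_injective] at hr
  refine (hfrac ⟨x, hxV⟩).trans (HomogeneousLocalization.val_injective _ ?_)
  change Localization.mk (r : MvPolynomial (Fin 3) k) _ = HomogeneousLocalization.val 0
  replace hr : (r : MvPolynomial (Fin 3) k) = 0 := hr
  rw [hr, Localization.mk_zero, HomogeneousLocalization.val_zero]

/-- The section `p / f ^ n` over `D₊(f)`. -/
def frac {f : MvPolynomial (Fin 3) k} {d : ℕ} (hf : f ∈ grading k d) (n : ℕ)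
    (p : MvPolynomial (Fin 3) k) (hp : p ∈ grading k (n • d)) :
    Γ(Plane k, Proj.basicOpen (grading k) f) :=
  (Proj.awayToSection (grading k) f).hom (HomogeneousLocalization.Away.mk (grading k) hf n p hp)

theorem exists_eq_frac {f : MvPolynomial (Fin 3) k} {d : ℕ} (hf : f ∈ grading k d) (hd : 0 < d)
    (a : Γ(Plane k, Proj.basicOpen (grading k) f)) :
    ∃ n p hp, a = frac hf n p hp := by
  let e := Proj.basicOpenIsoAway (grading k) f hf hd
  obtain ⟨n, p, hp, h⟩ := HomogeneousLocalization.Away.mk_surjective (grading k) hf (e.inv.hom a)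
  exact ⟨n, p, hp, by rw [frac, h]; exact (congr($(e.inv_hom_id).hom a)).symm⟩

theorem genericValue_frac_mul {f : MvPolynomial (Fin 3) k} (hf0 : f ≠ 0) {d : ℕ}
    (hf : f ∈ grading k d) (n : ℕ) (p : MvPolynomial (Fin 3) k) (hp : p ∈ grading k (n • d)) :
    genericValue _ (genericPt_mem_basicOpen hf0) (frac hf n p hp) * algebraMap _ _ f ^ n =
      algebraMap _ (Frac k) p := by
  rw [← map_pow]
  exact genericValue_mul_of_eq_mk (c := ⟨n • d, ⟨p, hp⟩, ⟨f ^ n, SetLike.pow_mem_graded n hf⟩, _⟩)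
    rfl

end GenericValue

section Constants

theorem constants_eq_of_ι_comp_eq {X : Scheme.{u}} {f : X ⟶ Spec (CommRingCat.of k)}
    {U : X.Opens} {φ : CommRingCat.of k ⟶ Γ(X, U)} (h : U.ι ≫ f = U.toSpecΓ ≫ Spec.map φ) :
    constants f U = φ.hom := by
  have h2 := congr((Scheme.ΓSpecIso (CommRingCat.of k)).inv ≫ Scheme.Hom.appTop $h ≫
    U.topIso.hom)
  simp only [Scheme.Hom.comp_appTop, Scheme.Opens.toSpecΓ_appTop, Category.assoc,
    Iso.inv_hom_id, Category.comp_id, Scheme.ΓSpecIso_naturality, Iso.inv_hom_id_assoc] at h2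
  have hU : U.ι.appTop ≫ U.topIso.hom = X.presheaf.map (homOfLE (le_top : U ≤ ⊤)).op := by
    rw [Scheme.Opens.ι_appTop, Scheme.Opens.topIso_hom]
    exact (X.presheaf.map_comp _ _).symm
  rw [← h2, constants, hU]

theorem basicOpen_ι_planeToSpec {f : MvPolynomial (Fin 3) k} {d : ℕ} (hf : f ∈ grading k d)
    (hd : 0 < d) :
    (Proj.basicOpen (grading k) f).ι ≫ planeToSpec k =
      (Proj.basicOpen (grading k) f).toSpecΓ ≫
        Spec.map (CommRingCat.ofHom (algebraMap k (grading k 0)) ≫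
          CommRingCat.ofHom (HomogeneousLocalization.fromZeroRingHom (grading k) _) ≫
          Proj.awayToSection (grading k) f) := by
  have h : (Proj.basicOpen (grading k) f).ι =
      Proj.basicOpenToSpec (grading k) f ≫ Proj.awayι (grading k) f hf hd := by
    rw [Proj.awayι, ← Proj.basicOpenIsoSpec_hom (grading k) f hf hd, Iso.hom_inv_id_assoc]
  rw [planeToSpec, h, Category.assoc, Proj.awayι_toSpecZero_assoc]
  simp [Proj.basicOpenToSpec]

theorem constants_basicOpen {f : MvPolynomial (Fin 3) k} {d : ℕ} (hf : f ∈ grading k d)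
    (hd : 0 < d) (c : k) :
    constants (planeToSpec k) (Proj.basicOpen (grading k) f) c =
      frac hf 0 (C c) (by rw [zero_smul]; exact isHomogeneous_C _ _) := by
  rw [constants_eq_of_ι_comp_eq (basicOpen_ι_planeToSpec hf hd)]
  refine congrArg (Proj.awayToSection (grading k) f).hom ?_
  apply HomogeneousLocalization.val_injective
  rw [HomogeneousLocalization.Away.val_mk]
  simp only [pow_zero]
  rfl

theorem genericValue_constants (U : (Plane k).Opens) (hU : genericPt k ∈ U) (c : k) :
    genericValue U hU (constants (planeToSpec k) U c) = algebraMap k (Frac k) c := by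
  have hres : ∀ V (hV : genericPt k ∈ V), genericValue V hV (constants (planeToSpec k) V c) =
      genericValue ⊤ trivial (constants (planeToSpec k) ⊤ c) := fun V hV => by
    rw [← genericValue_res le_top hV]
    simp [constants]
  have hX := isHomogeneous_X k (0 : Fin 3)
  have h := genericValue_frac_mul (X_ne_zero 0) hX 0 (C c)
    (by rw [zero_smul]; exact isHomogeneous_C _ _)
  rw [pow_zero, mul_one, ← constants_basicOpen hX one_pos, hres, ← hres U hU] at h
  rw [h, ← algebraMap_eq, ← IsScalarTower.algebraMap_apply]

end Constants

section Koszul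

theorem ker_aeval_ite_eq_span_X_image {σ R : Type*} [CommRing R] (s : Set σ)
    [DecidablePred (· ∈ s)] :
    RingHom.ker (aeval (R := R) fun i => if i ∈ s then 0 else (X i : MvPolynomial σ R)) =
      Ideal.span (X '' s) := by
  set g := aeval (R := R) fun i => if i ∈ s then 0 else (X i : MvPolynomial σ R)
  apply le_antisymm
  · have hg : (Ideal.Quotient.mkₐ R (Ideal.span (X '' s))).comp g = Ideal.Quotient.mkₐ R _ := by
      ext i
      by_cases hi : i ∈ s
      · simpa [g, hi, eq_comm (a := (0 : _ ⧸ _)), Ideal.Quotient.eq_zero_iff_mem] using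
          Ideal.subset_span (Set.mem_image_of_mem X hi)
      · simp [g, hi]
    intro p hp
    rw [← Ideal.Quotient.eq_zero_iff_mem, ← Ideal.Quotient.mkₐ_eq_mk R, ← hg, AlgHom.comp_apply,
      (RingHom.mem_ker).mp hp, map_zero]
  · rw [Ideal.span_le]
    rintro _ ⟨i, hi, rfl⟩
    simp [g, hi]

theorem isPrime_span_X_image {σ R : Type*} [CommRing R] [IsDomain R] (s : Set σ) :
    (Ideal.span (X '' s : Set (MvPolynomial σ R))).IsPrime := by
  classical
  rw [← ker_aeval_ite_eq_span_X_image s]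
  exact RingHom.ker_isPrime _

theorem X_notMem_span_X_image {σ R : Type*} [CommRing R] [Nontrivial R] {s : Set σ} {i : σ}
    (hi : i ∉ s) : (X i : MvPolynomial σ R) ∉ Ideal.span (X '' s) := by
  classical
  simp [← ker_aeval_ite_eq_span_X_image s, hi]

/-- Exactness of the Koszul complex of a regular sequence `x, y, z` in the middle. -/
theorem exists_eq_of_koszul {R : Type*} [CommRing R] {x y z p q r : R}
    (hx : x ∈ nonZeroDivisors R) (hy : ∀ c, x ∣ y * c → x ∣ c)
    (hz : ∀ c, z * c ∈ Ideal.span {x, y} → c ∈ Ideal.span {x, y})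
    (h : z * p + x * q = y * r) :
    ∃ a b c, p = x * b - y * a ∧ r = x * c - z * a ∧ q = y * c - z * b := by
  obtain ⟨b, a, hab⟩ := Ideal.mem_span_pair.mp (hz p (Ideal.mem_span_pair.mpr
    ⟨-q, r, by linear_combination -h⟩))
  obtain ⟨c, hc⟩ := hy (r - z * a) ⟨q + z * b, by linear_combination -h - z * hab⟩
  refine ⟨-a, b, c, by linear_combination -hab, by linear_combination hc, ?_⟩
  apply (mem_nonZeroDivisors_iff_left.mp hx _ · |> sub_eq_zero.mp)
  linear_combination h + z * hab + y * hc

variable (k) in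
/-- The space of linear forms on the plane. -/
abbrev LinearForm : Type u := grading k 1

theorem exists_linearForm_koszul {p q r : MvPolynomial (Fin 3) k} (hp : p ∈ grading k 2)
    (hq : q ∈ grading k 2) (hr : r ∈ grading k 2) (h : X 2 * p + X 0 * q = X 1 * r) :
    ∃ d : Fin 3 → LinearForm k, p = X 0 * (d 1).1 - X 1 * (d 0).1 ∧
      r = X 0 * (d 2).1 - X 2 * (d 0).1 ∧
      q = X 1 * (d 2).1 - X 2 * (d 1).1 := by
  have hpair : ({X 0, X 1} : Set (MvPolynomial (Fin 3) k)) = X '' {0, 1} :=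
    (Set.image_pair _ _ _).symm
  obtain ⟨a, b, c, hp', hr', hq'⟩ := exists_eq_of_koszul
    (mem_nonZeroDivisors_of_ne_zero (X_ne_zero 0))
    (fun c hc => ((X_prime (i := (0 : Fin 3))).dvd_or_dvd hc).resolve_left (by simp [X_dvd_X]))
    (fun c hc => by
      rw [hpair] at hc ⊢
      exact ((isPrime_span_X_image _).mem_or_mem hc).resolve_left
        (X_notMem_span_X_image (by decide))) h
  have hdeg : ∀ {e f s : MvPolynomial (Fin 3) k} {i j : Fin 3}, s ∈ grading k 2 →
      s = X i * e - X j * f → s = X i * (DirectSum.decompose (grading k) e 1).1 -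
        X j * (DirectSum.decompose (grading k) f 1).1 := by
    intro e f s i j hs hef
    have hX : ∀ (i : Fin 3) (g : MvPolynomial (Fin 3) k),
        (DirectSum.decompose (grading k) (X i * g) 2).1 =
          X i * (DirectSum.decompose (grading k) g 1).1 := fun i g =>
      DirectSum.coe_decompose_mul_add_of_left_mem (grading k) (i := 1) (j := 1)
        (isHomogeneous_X k i)
    rw [← hX, ← hX, ← Submodule.coe_sub, ← DirectSum.sub_apply, ← DirectSum.decompose_sub, ← hef,
      DirectSum.decompose_of_mem_same (grading k) hs]
  exact ⟨fun i => DirectSum.decompose (grading k) (![a, b, c] i) 1, hdeg hp hp', hdeg hr hr',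
    hdeg hq hq'⟩

end Koszul

section LinearForms

variable (k) in
/-- The coordinates `X 0, X 1, X 2`, as a basis of the space of linear forms. -/
def coordBasis : Module.Basis (Fin 3) k (LinearForm k) :=
  (Module.Basis.span (linearIndependent_X (Fin 3) k)).map
    (LinearEquiv.ofEq _ _ homogeneousSubmodule_one_eq_span_X.symm)

theorem coe_coordBasis (i : Fin 3) : (coordBasis k i : MvPolynomial (Fin 3) k) = X i := by
  simp [coordBasis, Module.Basis.span_apply]

theorem finrank_linearForm : Module.finrank k (LinearForm k) = 3 := by
  simpa using Module.finrank_eq_card_basis (coordBasis k)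

end LinearForms

section Ratio

variable {l m : LinearForm k}

theorem genericPt_mem_basicOpen_linearForm (hl : l ≠ 0) :
    genericPt k ∈ Proj.basicOpen (grading k) l.1 :=
  genericPt_mem_basicOpen (Subtype.coe_ne_coe.mpr hl)

variable (k) in
/-- The inclusion of the linear forms in the field of fractions of the coordinate ring. -/
def toFrac : LinearForm k →ₗ[k] Frac k :=
  (IsScalarTower.toAlgHom k (MvPolynomial (Fin 3) k) (Frac k)).toLinearMap ∘ₗ (grading k 1).subtype

theorem toFrac_apply (l : LinearForm k) : toFrac k l = algebraMap _ (Frac k) l.1 := rfl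

theorem toFrac_ne_zero (hl : l ≠ 0) : toFrac k l ≠ 0 :=
  algebraMap_frac_ne_zero (Subtype.coe_ne_coe.mpr hl)

/-- The quotient `m / l` of two linear forms, as a section over `D₊(l)`. -/
def ratio (l m : LinearForm k) : Γ(Plane k, Proj.basicOpen (grading k) l.1) :=
  frac l.2 1 m.1 m.2

theorem genericValue_ratio (hl : l ≠ 0) (m : LinearForm k) :
    genericValue _ (genericPt_mem_basicOpen_linearForm hl) (ratio l m) =
      toFrac k m / toFrac k l := by
  rw [eq_div_iff (toFrac_ne_zero hl)]
  rw [toFrac_apply, toFrac_apply, ← pow_one (algebraMap _ _ l.1)]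
  exact genericValue_frac_mul (Subtype.coe_ne_coe.mpr hl) l.2 1 m.1 m.2

theorem ratio_self (hl : l ≠ 0) : ratio l l = 1 := by
  apply genericValue_injective _ (genericPt_mem_basicOpen_linearForm hl)
  rw [genericValue_ratio hl, map_one, div_self (toFrac_ne_zero hl)]

theorem ratio_add (hl : l ≠ 0) (m n : LinearForm k) :
    ratio l (m + n) = ratio l m + ratio l n := by
  apply genericValue_injective _ (genericPt_mem_basicOpen_linearForm hl)
  simp only [map_add, genericValue_ratio hl, add_div]

theorem ratio_smul (hl : l ≠ 0) (c : k) (m : LinearForm k) :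
    ratio l (c • m) = constants (planeToSpec k) _ c * ratio l m := by
  apply genericValue_injective _ (genericPt_mem_basicOpen_linearForm hl)
  simp only [map_mul, map_smul, genericValue_ratio hl, genericValue_constants, Algebra.smul_def,
    mul_div_assoc]

end Ratio

section VectorFields

variable (s : TangentSection (planeToSpec k))

theorem genericValue_der_mul {U V W : (Plane k).Opens} {hU : genericPt k ∈ U}
    {hV : genericPt k ∈ V} {hW : genericPt k ∈ W} {a : Γ(Plane k, U)} {b : Γ(Plane k, V)}
    {c : Γ(Plane k, W)} (h : genericValue U hU a * genericValue V hV b = genericValue W hW c) :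
    genericValue U hU a * genericValue V hV (s.der V b) +
      genericValue V hV b * genericValue U hU (s.der U a) = genericValue W hW (s.der W c) := by
  have hle₁ : U ⊓ V ⊓ W ≤ U := inf_le_left.trans inf_le_left
  have hle₂ : U ⊓ V ⊓ W ≤ V := inf_le_left.trans inf_le_right
  have hle₃ : U ⊓ V ⊓ W ≤ W := inf_le_right
  have hη : genericPt k ∈ U ⊓ V ⊓ W := ⟨⟨hU, hV⟩, hW⟩
  have hmul : ((Plane k).presheaf.map (homOfLE hle₁).op).hom a *
      ((Plane k).presheaf.map (homOfLE hle₂).op).hom b =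
        ((Plane k).presheaf.map (homOfLE hle₃).op).hom c :=
    genericValue_injective _ hη (by rw [map_mul]; exact h)
  have hder := congrArg (s.der _) hmul
  rw [Derivation.leibniz, s.der_restrict _ _ hle₁, s.der_restrict _ _ hle₂,
    s.der_restrict _ _ hle₃, smul_eq_mul, smul_eq_mul] at hder
  simpa only [map_add, map_mul, genericValue_res] using congrArg (genericValue _ hη) hder

theorem der_constants_mul {U : (Plane k).Opens} (c : k) (a : Γ(Plane k, U)) :
    s.der U (constants (planeToSpec k) U c * a) =
      constants (planeToSpec k) U c * s.der U a := by
  rw [Derivation.leibniz, s.der_constants, smul_zero, add_zero, smul_eq_mul]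

variable {l m : LinearForm k}

/-- The expression `l ^ 2 * s (m / l)`, as a linear function of `m`. If `s` came from a derivation
`D` of the coordinate ring, it would be the Wronskian `l * D m - m * D l`. -/
def wronskian (hl : l ≠ 0) : LinearForm k →ₗ[k] Frac k where
  toFun m := genericValue _ (genericPt_mem_basicOpen_linearForm hl) (s.der _ (ratio l m)) *
    toFrac k l ^ 2
  map_add' m n := by rw [ratio_add hl, map_add, map_add, add_mul]
  map_smul' c m := by
    rw [ratio_smul hl, der_constants_mul, map_mul, genericValue_constants, mul_assoc,
      ← Algebra.smul_def, RingHom.id_apply]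

theorem wronskian_self (hl : l ≠ 0) : wronskian s hl l = 0 := by
  simp [wronskian, ratio_self hl]

theorem toFrac_mul_wronskian (hl : l ≠ 0) (hm : m ≠ 0) (n : LinearForm k) :
    toFrac k m * wronskian s hl n =
      toFrac k l * wronskian s hm n + toFrac k n * wronskian s hl m := by
  have hl' := toFrac_ne_zero hl
  have hm' := toFrac_ne_zero hm
  have h := genericValue_der_mul s (a := ratio l m) (b := ratio m n) (c := ratio l n)
    (hU := genericPt_mem_basicOpen_linearForm hl) (hV := genericPt_mem_basicOpen_linearForm hm)
    (hW := genericPt_mem_basicOpen_linearForm hl) (by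
      simp only [genericValue_ratio hl, genericValue_ratio hm]
      field_simp)
  simp only [genericValue_ratio hl, genericValue_ratio hm] at h
  simp only [wronskian, LinearMap.coe_mk, AddHom.coe_mk, ← h]
  field_simp

theorem mem_grading_of_mul_mem {f r : MvPolynomial (Fin 3) k} {m d : ℕ} (hf0 : f ≠ 0)
    (hf : f ∈ grading k m) (h : f * r ∈ grading k (m + d)) : r ∈ grading k d := by
  have h1 := DirectSum.coe_decompose_mul_add_of_left_mem (grading k) (i := m) (j := d) (b := r) hf
  rw [DirectSum.decompose_of_mem_same (grading k) h] at h1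
  rw [mul_left_cancel₀ hf0 h1]
  exact SetLike.coe_mem _

theorem exists_wronskian_mul_pow (hl : l ≠ 0) (m : LinearForm k) :
    ∃ n, ∃ p ∈ grading k n,
      wronskian s hl m * toFrac k l ^ n = algebraMap _ (Frac k) (l.1 ^ 2 * p) := by
  obtain ⟨n, p, hp, h⟩ := exists_eq_frac l.2 one_pos (s.der _ (ratio l m))
  refine ⟨n, p, by simpa using hp, ?_⟩
  rw [map_mul, ← genericValue_frac_mul (Subtype.coe_ne_coe.mpr hl) l.2 n p hp, ← h]
  simp only [wronskian, LinearMap.coe_mk, AddHom.coe_mk, toFrac_apply, map_pow]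
  ring

/-- By antisymmetry only powers of `l` and only powers of `m` occur in the denominator. -/
theorem exists_wronskian_eq_algebraMap (hl : Prime l.1) (hl0 : l ≠ 0) (hlm : ¬ l.1 ∣ m.1) :
    ∃ r ∈ grading k 2, wronskian s hl0 m = algebraMap _ (Frac k) r := by
  have hm0 : m ≠ 0 := by rintro rfl; exact hlm (dvd_zero _)
  obtain ⟨n, p, hp, hW⟩ := exists_wronskian_mul_pow s hl0 m
  obtain ⟨n', q, -, hW'⟩ := exists_wronskian_mul_pow s hm0 l
  have hanti : wronskian s hm0 l = -wronskian s hl0 m := by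
    have h := toFrac_mul_wronskian s hl0 hm0 l
    rw [wronskian_self, mul_zero, ← mul_add, eq_comm] at h
    exact eq_neg_of_add_eq_zero_left ((mul_eq_zero.mp h).resolve_left (toFrac_ne_zero hl0))
  have hpq : m.1 ^ n' * (l.1 ^ 2 * p) = l.1 ^ n * -(m.1 ^ 2 * q) := by
    apply algebraMap_frac_injective
    rw [map_mul, ← hW, map_mul, map_neg, ← hW', hanti]
    simp only [toFrac_apply, map_pow]
    ring
  obtain ⟨r, hr⟩ := hl.pow_dvd_of_dvd_mul_left n (fun h => hlm (hl.dvd_of_dvd_pow h)) ⟨_, hpq⟩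
  have hln : l.1 ^ n ∈ grading k n := by simpa using SetLike.pow_mem_graded n l.2
  refine ⟨r, mem_grading_of_mul_mem (pow_ne_zero n hl.ne_zero) hln ?_, ?_⟩
  · rw [← hr, add_comm]
    exact SetLike.mul_mem_graded (SetLike.pow_mem_graded 2 l.2) hp
  · rw [hr, map_mul, mul_comm, map_pow] at hW
    exact mul_left_cancel₀ (pow_ne_zero n (toFrac_ne_zero hl0)) hW

theorem exists_wronskian_coordBasis_eq :
    ∃ T : Module.End k (LinearForm k), wronskian s ((coordBasis k).ne_zero 0) =
      toFrac k (coordBasis k 0) • (toFrac k ∘ₗ T) -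
        toFrac k (T (coordBasis k 0)) • toFrac k := by
  have hprime (i : Fin 3) : Prime (coordBasis k i).1 := coe_coordBasis (k := k) i ▸ X_prime
  have hdvd {i j : Fin 3} (hij : i ≠ j) : ¬ (coordBasis k i).1 ∣ (coordBasis k j).1 := by
    simpa [coe_coordBasis, X_dvd_X] using hij
  have hex {i j : Fin 3} (hij : i ≠ j) :=
    exists_wronskian_eq_algebraMap s (hprime i) ((coordBasis k).ne_zero i) (hdvd hij)
  obtain ⟨p, hp, hWp⟩ := hex (show (0 : Fin 3) ≠ 1 by decide)
  obtain ⟨r, hr, hWr⟩ := hex (show (0 : Fin 3) ≠ 2 by decide)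
  obtain ⟨q, hq, hWq⟩ := hex (show (1 : Fin 3) ≠ 2 by decide)
  have hcocycle : X 2 * p + X 0 * q = X 1 * r := by
    have h := toFrac_mul_wronskian s ((coordBasis k).ne_zero 0) ((coordBasis k).ne_zero 1)
      (coordBasis k 2)
    simp only [hWp, hWq, hWr, toFrac_apply, coe_coordBasis, ← map_mul, ← map_add] at h
    rw [algebraMap_frac_injective h, add_comm]
  obtain ⟨d, hpd, hrd, -⟩ := exists_linearForm_koszul hp hq hr hcocycle
  refine ⟨(coordBasis k).constr k d, (coordBasis k).ext fun i => ?_⟩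
  simp only [LinearMap.sub_apply, LinearMap.smul_apply, LinearMap.comp_apply, smul_eq_mul,
    Module.Basis.constr_basis]
  fin_cases i
  · simpa [mul_comm] using wronskian_self s ((coordBasis k).ne_zero 0)
  · simp only [Fin.mk_one, hWp, hpd, toFrac_apply, coe_coordBasis, map_sub, map_mul]
    ring
  · simp only [Fin.reduceFinMk, hWr, hrd, toFrac_apply, coe_coordBasis, map_sub, map_mul]
    ring

/-- The vector field `s` is the image of the endomorphism `T` of the space of linear forms under the
surjection of the Euler sequence: the derivation of the coordinate ring that extends `T` induces `s`
on the functions `m / l`. -/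
def IsVectorFieldOf (T : Module.End k (LinearForm k)) : Prop :=
  ∀ l : LinearForm k, l ≠ 0 → ∀ m,
    s.der _ (ratio l m) = ratio l (T m) - ratio l m * ratio l (T l)

theorem exists_isVectorFieldOf : ∃ T, IsVectorFieldOf s T := by
  obtain ⟨T, hT⟩ := exists_wronskian_coordBasis_eq s
  refine ⟨T, fun l hl m => ?_⟩
  have hl' := toFrac_ne_zero hl
  have hW : wronskian s hl m = toFrac k l * toFrac k (T m) - toFrac k (T l) * toFrac k m := by
    have h := toFrac_mul_wronskian s ((coordBasis k).ne_zero 0) hl m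
    simp only [hT, LinearMap.sub_apply, LinearMap.smul_apply, LinearMap.comp_apply,
      smul_eq_mul] at h
    apply mul_left_cancel₀ (toFrac_ne_zero ((coordBasis k).ne_zero 0))
    linear_combination -h
  apply genericValue_injective _ (genericPt_mem_basicOpen_linearForm hl)
  rw [map_sub, map_mul, genericValue_ratio hl, genericValue_ratio hl, genericValue_ratio hl]
  change genericValue _ _ _ * _ = _ at hW
  field_simp
  linear_combination hW

end VectorFields

section Charts

theorem mem_basicOpen_ratio {l m : LinearForm k} {x : Plane k}
    (hx : x ∈ Proj.basicOpen (grading k) l.1) :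
    x ∈ (Plane k).basicOpen (ratio l m) ↔ x ∈ Proj.basicOpen (grading k) m.1 := by
  have hstalk : IsUnit ((Plane k).presheaf.germ _ x hx (ratio l m)) ↔
      IsUnit ((ProjectiveSpectrum.Proj.awayToSection (grading k) l.1).hom'
        (HomogeneousLocalization.Away.mk (grading k) l.2 1 m.1 m.2) |>.1 ⟨x, hx⟩) := by
    refine (MulEquiv.isUnit_map (Proj.stalkIso' (grading k) x)).symm.trans ?_
    exact iff_of_eq (congrArg IsUnit (Proj.stalkIso'_germ (grading k) _ x hx (ratio l m)))
  rw [Scheme.mem_basicOpen (Plane k) (ratio l m) x hx, hstalk,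
    ← HomogeneousLocalization.isUnit_iff_isUnit_val,
    ProjectiveSpectrum.Proj.awayToSection_apply, HomogeneousLocalization.Away.val_mk,
    Localization.mk_eq_mk', IsLocalization.map_mk', IsLocalization.AtPrime.isUnit_mk'_iff]
  rfl

variable (b : Module.Basis (Fin 3) k (LinearForm k)) (i : Fin 3)

/-- The affine chart of the plane where the `i`-th linear form of a basis does not vanish. -/
abbrev chart : (Plane k).affineOpens :=
  ⟨Proj.basicOpen (grading k) (b i).1, Proj.isAffineOpen_basicOpen _ _ (b i).2 one_pos⟩

theorem iSup_chart : ⨆ i, (chart b i).1 = ⊤ := by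
  apply Proj.iSup_basicOpen_eq_top' _ _ fun i => ⟨1, (b i).2⟩
  set A := Algebra.adjoin (grading k 0) (Set.range fun i => (b i).1)
  have hC (c : k) : C c ∈ A :=
    A.algebraMap_mem (⟨C c, isHomogeneous_C _ _⟩ : grading k 0)
  have hX (j : Fin 3) : X j ∈ A := by
    rw [← coe_coordBasis, ← b.sum_repr (coordBasis k j), Submodule.coe_sum]
    refine sum_mem fun n _ => ?_
    rw [Submodule.coe_smul, smul_eq_C_mul]
    exact mul_mem (hC _) (Algebra.subset_adjoin ⟨n, rfl⟩)
  rw [eq_top_iff]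
  intro p _
  induction p using MvPolynomial.induction_on with
  | C c => exact hC c
  | add p q hp hq => exact add_mem (hp trivial) (hq trivial)
  | mul_X p j hp => exact mul_mem (hp trivial) (hX j)

theorem exists_mem_chart (x : Plane k) : ∃ i, x ∈ (chart b i).1 :=
  Opens.mem_iSup.mp (iSup_chart b ▸ Opens.mem_top x)

theorem genericPt_mem_chart : genericPt k ∈ (chart b i).1 :=
  genericPt_mem_basicOpen_linearForm (b.ne_zero i)

/-- The homogeneous coordinates in terms of the affine coordinates on the `i`-th chart. -/
def affineCoord : Fin 3 → MvPolynomial (Fin 2) k :=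
  i.insertNth (α := fun _ => MvPolynomial (Fin 2) k) 1 X

@[simp]
theorem affineCoord_same : affineCoord (k := k) i i = 1 := by simp [affineCoord]

@[simp]
theorem affineCoord_succAbove (j : Fin 2) : affineCoord (k := k) i (i.succAbove j) = X j := by
  simp [affineCoord]

/-- The coordinate map `k[u, v] ⟶ Γ(P², D₊(b i))`. -/
def chartMap : MvPolynomial (Fin 2) k →+* Γ(Plane k, chart b i) :=
  eval₂Hom (constants (planeToSpec k) _) fun j => ratio (b i) (b (i.succAbove j))

theorem chartMap_C (c : k) : chartMap b i (C c) = constants (planeToSpec k) _ c :=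
  eval₂Hom_C _ _ _

theorem chartMap_affineCoord (n : Fin 3) :
    chartMap b i (affineCoord i n) = ratio (b i) (b n) := by
  rcases Fin.eq_self_or_eq_succAbove i n with rfl | ⟨j, rfl⟩
  · rw [affineCoord_same, map_one, ratio_self (b.ne_zero _)]
  · rw [affineCoord_succAbove]
    exact eval₂Hom_X' _ _ _

/-- Dehomogenization with respect to the `i`-th form of a basis. -/
def dehomogenize : MvPolynomial (Fin 3) k →ₐ[k] MvPolynomial (Fin 2) k :=
  aeval fun m => b.constr k (affineCoord i) (coordBasis k m)

theorem dehomogenize_coe (l : LinearForm k) :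
    dehomogenize b i l.1 = b.constr k (affineCoord i) l := by
  suffices h : (dehomogenize b i).toLinearMap ∘ₗ (grading k 1).subtype =
      b.constr k (affineCoord i) from congr($h l)
  refine (coordBasis k).ext fun m => ?_
  simp [dehomogenize, coe_coordBasis]

theorem dehomogenize_basis (n : Fin 3) : dehomogenize b i (b n).1 = affineCoord i n := by
  rw [dehomogenize_coe, b.constr_basis]

theorem chartMap_dehomogenize (l : LinearForm k) :
    chartMap b i (dehomogenize b i l.1) = ratio (b i) l := by
  have hi := b.ne_zero i
  induction b.mem_span l using Submodule.span_induction with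
  | mem _ h =>
    obtain ⟨n, rfl⟩ := h
    rw [dehomogenize_basis, chartMap_affineCoord]
  | zero => simpa using (ratio_smul hi 0 0).symm
  | add l m _ _ hl hm => rw [Submodule.coe_add, map_add, map_add, hl, hm, ratio_add hi]
  | smul c l _ hl =>
    rw [Submodule.coe_smul, map_smul, smul_eq_C_mul, map_mul, chartMap_C, hl, ratio_smul hi]

theorem map_mul_pow_of_isHomogeneous {σ R S : Type*} [Finite σ] [CommSemiring R] [CommSemiring S]
    (f g : MvPolynomial σ R →+* S) (t : S) (hC : ∀ c, f (C c) = g (C c))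
    (hX : ∀ m, f (X m) * t = g (X m)) {n : ℕ} {p : MvPolynomial σ R}
    (hp : p.IsHomogeneous n) : f p * t ^ n = g p := by
  have := Fintype.ofFinite σ
  rw [p.as_sum]
  simp only [map_sum, Finset.sum_mul]
  refine Finset.sum_congr rfl fun d hd => ?_
  have hdeg : d.degree = n := by
    by_contra h
    exact (mem_support_iff.mp hd) (hp.coeff_eq_zero h)
  rw [monomial_eq, Finsupp.prod_fintype _ _ (by simp), ← hdeg, Finsupp.degree_eq_sum,
    ← Finset.prod_pow_eq_pow_sum]
  simp only [map_mul, map_prod, map_pow, ← hX, mul_pow, Finset.prod_mul_distrib, hC]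
  ring

theorem genericValue_chartMap_dehomogenize_mul {n : ℕ} {p : MvPolynomial (Fin 3) k}
    (hp : p ∈ grading k n) :
    genericValue _ (genericPt_mem_chart b i) (chartMap b i (dehomogenize b i p)) *
      toFrac k (b i) ^ n = algebraMap _ (Frac k) p := by
  refine map_mul_pow_of_isHomogeneous
    (((genericValue _ (genericPt_mem_chart b i)).comp (chartMap b i)).comp
      (dehomogenize b i).toRingHom) (algebraMap _ (Frac k)) _ (fun c => ?_) (fun m => ?_) hp
  · change genericValue _ _ (chartMap b i (dehomogenize b i (algebraMap k _ c))) = _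
    rw [AlgHom.commutes, algebraMap_eq, chartMap_C, genericValue_constants, ← algebraMap_eq,
      ← IsScalarTower.algebraMap_apply]
  · change genericValue _ _ (chartMap b i (dehomogenize b i (X m))) * _ = _
    rw [← coe_coordBasis, chartMap_dehomogenize, genericValue_ratio (b.ne_zero i),
      div_mul_cancel₀ _ (toFrac_ne_zero (b.ne_zero i)), toFrac_apply]

theorem exists_dehomogenize_eq (q : MvPolynomial (Fin 2) k) :
    ∃ n, ∃ p ∈ grading k n, dehomogenize b i p = q := by
  induction q using MvPolynomial.induction_on with
  | C c => exact ⟨0, C c, isHomogeneous_C _ _, (dehomogenize b i).commutes c⟩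
  | add q₁ q₂ h₁ h₂ =>
    obtain ⟨n₁, p₁, hp₁, rfl⟩ := h₁
    obtain ⟨n₂, p₂, hp₂, rfl⟩ := h₂
    have hpow (n : ℕ) : (b i).1 ^ n ∈ grading k n := by
      simpa using SetLike.pow_mem_graded n (b i).2
    refine ⟨n₁ + n₂, p₁ * (b i).1 ^ n₂ + (b i).1 ^ n₁ * p₂,
      add_mem (SetLike.mul_mem_graded hp₁ (hpow n₂)) (SetLike.mul_mem_graded (hpow n₁) hp₂), ?_⟩
    simp [dehomogenize_basis]
  | mul_X q j h =>
    obtain ⟨n, p, hp, rfl⟩ := h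
    refine ⟨n + 1, p * (b (i.succAbove j)).1, SetLike.mul_mem_graded hp (b _).2, ?_⟩
    simp [dehomogenize_basis]

theorem chartMap_injective : Function.Injective (chartMap b i) := by
  rw [injective_iff_map_eq_zero]
  intro q hq
  obtain ⟨n, p, hp, rfl⟩ := exists_dehomogenize_eq b i q
  have h := genericValue_chartMap_dehomogenize_mul b i hp
  rw [hq, map_zero, zero_mul, eq_comm, map_eq_zero_iff _ algebraMap_frac_injective] at h
  rw [h, map_zero]

theorem chartMap_surjective : Function.Surjective (chartMap b i) := by
  intro a
  obtain ⟨n, p, hp, rfl⟩ := exists_eq_frac (b i).2 one_pos a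
  refine ⟨dehomogenize b i p, genericValue_injective _ (genericPt_mem_chart b i) ?_⟩
  apply mul_right_cancel₀ (pow_ne_zero n (toFrac_ne_zero (b.ne_zero i)))
  have hp' : p ∈ grading k n := by simpa using hp
  rw [genericValue_chartMap_dehomogenize_mul b i hp']
  exact (genericValue_frac_mul (Subtype.coe_ne_coe.mpr (b.ne_zero i)) (b i).2 n p hp).symm

/-- The coordinate ring of the `i`-th chart is a polynomial ring in two variables. -/
def chartIso : MvPolynomial (Fin 2) k ≃+* Γ(Plane k, chart b i) :=
  RingEquiv.ofBijective (chartMap b i) ⟨chartMap_injective b i, chartMap_surjective b i⟩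

end Charts

section ZeroScheme

variable {s : TangentSection (planeToSpec k)} {T : Module.End k (LinearForm k)}

/-- The components, on the `i`-th chart, of the vector field of the endomorphism `T`: the images of
the affine coordinates under it. -/
def component (b : Module.Basis (Fin 3) k (LinearForm k)) (T : Module.End k (LinearForm k))
    (i m : Fin 3) : MvPolynomial (Fin 2) k :=
  dehomogenize b i (T (b m)).1 - affineCoord i m * dehomogenize b i (T (b i)).1

theorem der_chartMap_affineCoord (hs : IsVectorFieldOf s T)
    (b : Module.Basis (Fin 3) k (LinearForm k)) (i m : Fin 3) :
    s.der _ (chartMap b i (affineCoord i m)) = chartMap b i (component b T i m) := by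
  rw [component, map_sub, map_mul, chartMap_dehomogenize, chartMap_dehomogenize,
    chartMap_affineCoord]
  exact hs _ (b.ne_zero i) _

theorem zeroIdeal_chart (hs : IsVectorFieldOf s T)
    (b : Module.Basis (Fin 3) k (LinearForm k)) (i : Fin 3) :
    s.zeroIdeal.ideal (chart b i) =
      (Ideal.span (Set.range (component b T i))).map (chartIso b i) := by
  have hmem (m : Fin 3) : s.der _ (chartMap b i (affineCoord i m)) ∈
      (Ideal.span (Set.range (component b T i))).map (chartMap b i) := by
    rw [der_chartMap_affineCoord hs]
    exact Ideal.mem_map_of_mem _ (Ideal.subset_span ⟨m, rfl⟩)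
  change Ideal.span (Set.range (s.der (chart b i).1)) =
    (Ideal.span (Set.range (component b T i))).map (chartMap b i)
  apply le_antisymm
  · rw [Ideal.span_le]
    rintro _ ⟨a, rfl⟩
    obtain ⟨q, rfl⟩ := chartMap_surjective b i a
    induction q using MvPolynomial.induction_on with
    | C c => rw [chartMap_C, s.der_constants]; exact zero_mem _
    | add p q hp hq => rw [map_add, map_add]; exact add_mem hp hq
    | mul_X p j hp =>
      rw [map_mul, Derivation.leibniz, ← affineCoord_succAbove i]
      exact add_mem (Ideal.mul_mem_left _ _ (hmem _)) (Ideal.mul_mem_left _ _ hp)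
  · rw [Ideal.map_span, Ideal.span_le]
    rintro _ ⟨_, ⟨m, rfl⟩, rfl⟩
    rw [← der_chartMap_affineCoord hs]
    exact Ideal.subset_span ⟨_, rfl⟩

theorem eq_zero_of_zeroIdeal_eq_bot {X : Scheme.{u}} {f : X ⟶ Spec (CommRingCat.of k)}
    {s : TangentSection f} (h : s.zeroIdeal = ⊥) : s = 0 := by
  have haff (U : X.affineOpens) (a : Γ(X, U.1)) : s.der U.1 a = 0 := by
    have ha : s.der U.1 a ∈ s.zeroIdeal.ideal U := Ideal.subset_span ⟨a, rfl⟩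
    rwa [h] at ha
  ext U a
  refine X.sheaf.eq_of_locally_eq' (fun V : {V : X.affineOpens // V.1 ≤ U} => V.1.1)
    U (fun V => homOfLE V.2) ?_ _ _ ?_
  · intro x hx
    obtain ⟨_, ⟨V, hV, rfl⟩, hxV, hVU⟩ := X.isBasis_affineOpens.exists_subset_of_mem_open hx U.2
    exact Opens.mem_iSup.mpr ⟨⟨⟨V, hV⟩, hVU⟩, hxV⟩
  · intro V
    refine (s.der_restrict U V.1.1 V.2 a).symm.trans ((haff V.1 _).trans ?_)
    exact (map_zero (X.presheaf.map (homOfLE V.2).op).hom).symm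

theorem ne_algebraMap_of_isVectorFieldOf (hs : IsVectorFieldOf s T) (hs0 : s ≠ 0) (c : k) :
    T ≠ algebraMap k _ c := by
  rintro rfl
  refine hs0 (eq_zero_of_zeroIdeal_eq_bot ?_)
  refine Scheme.IdealSheafData.ext_of_iSup_eq_top _ (iSup_chart (coordBasis k)) fun i => ?_
  have h : component (coordBasis k) (algebraMap k _ c) i = 0 := by
    funext m
    simp [component, dehomogenize_basis]
  rw [zeroIdeal_chart hs, h, Set.range_zero, Ideal.span_singleton_zero, Ideal.map_bot]
  rfl

end ZeroScheme

section Subschemes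

variable {X : Scheme.{u}} (I : X.IdealSheafData) (U : X.affineOpens)

instance : IsOpenImmersion (I.subschemeCover.f U) :=
  I.subschemeCover.map_prop U

theorem subschemeCover_injective : Function.Injective (I.subschemeCover.f U) :=
  (I.subschemeCover.f U).isOpenEmbedding.injective

theorem exists_subschemeCover_eq {x : I.subscheme} (hx : I.subschemeι x ∈ U.1) :
    ∃ y, I.subschemeCover.f U y = x := by
  have hx' : x ∈ (I.subschemeCover.f U).opensRange := by
    rw [I.opensRange_subschemeCover_map U]
    exact hx
  exact hx'

/-- The local rings of a closed subscheme are localizations of `Γ(X, U) ⧸ I(U)`. -/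
def stalkEquiv (y : PrimeSpectrum (Γ(X, U.1) ⧸ I.ideal U)) :
    I.subscheme.presheaf.stalk (I.subschemeCover.f U y) ≃+* Localization.AtPrime y.asIdeal :=
  have hiso (z : Spec (I.subschemeCover.X U)) :
      IsIso ((I.subschemeCover.f U).stalkMap z) := inferInstance
  have := hiso y
  (asIso ((I.subschemeCover.f U).stalkMap y) ≪≫
    Spec.stalkIso (.of (Γ(X, U.1) ⧸ I.ideal U)) y).commRingCatIsoToRingEquiv

theorem exists_bijective_roots [IsAlgClosed k] (hU : ∀ x, I.subschemeι x ∈ U.1)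
    {π : Polynomial k →+* Γ(X, U.1) ⧸ I.ideal U} {f : Polynomial k}
    (hπ : Function.Surjective π) (hker : RingHom.ker π = Ideal.span {f}) (hf : f ≠ 0) :
    ∃ φ : {a // a ∈ f.roots} → I.subscheme, Function.Bijective φ ∧
      ∀ a, multiplicity I.subscheme (φ a) = f.rootMultiplicity a.1 := by
  obtain ⟨φ, hφ, hmem⟩ := exists_bijective_roots_primeSpectrum hπ hker hf
  have hcover : Function.Bijective (I.subschemeCover.f U) :=
    ⟨subschemeCover_injective I U, fun x => exists_subschemeCover_eq I U (hU x)⟩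
  refine ⟨fun a => I.subschemeCover.f U (φ a), hcover.comp hφ, fun a => ?_⟩
  rw [multiplicity, length_eq_of_ringEquiv (stalkEquiv I U (φ a)),
    length_localization_eq_rootMultiplicity hπ hker hf _ (hmem a)]

end Subschemes

section CardThree

variable {α : Type*}

theorem multiset_card_eq_three_cases {m : Multiset α} (hm : m.card = 3) :
    (∃ x y z, x ≠ y ∧ x ≠ z ∧ y ≠ z ∧ m = {x, y, z}) ∨ (∃ x y, x ≠ y ∧ m = {x, x, y}) ∨
      ∃ x, m = {x, x, x} := by
  obtain ⟨x, y, z, rfl⟩ := Multiset.card_eq_three.mp hm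
  by_cases hxy : x = y
  · subst hxy
    by_cases hxz : x = z
    · exact .inr (.inr ⟨x, hxz ▸ rfl⟩)
    · exact .inr (.inl ⟨x, z, hxz, rfl⟩)
  by_cases hxz : x = z
  · exact .inr (.inl ⟨x, y, hxy, hxz ▸ congrArg (x ::ₘ ·) (Multiset.pair_comm y x)⟩)
  by_cases hyz : y = z
  · exact .inr (.inl ⟨y, x, Ne.symm hxy, by
      rw [← hyz]
      exact (Multiset.cons_swap x y {y}).trans (congrArg (y ::ₘ ·) (Multiset.pair_comm x y))⟩)
  exact .inl ⟨x, y, z, hxy, hxz, hyz, rfl⟩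

theorem points_of_bijective_multiset [DecidableEq α] {Z : Scheme.{u}} {m : Multiset α}
    (hm : m.card = 3) {φ : {a // a ∈ m} → Z} (hφ : Function.Bijective φ)
    (hmult : ∀ a, multiplicity Z (φ a) = m.count a.1) :
    IsThreePoints Z ∨ IsDoubleAndSimplePoint Z ∨ IsTriplePoint Z := by
  rcases multiset_card_eq_three_cases hm with
    ⟨x, y, z, hxy, hxz, hyz, rfl⟩ | ⟨x, y, hxy, rfl⟩ | ⟨x, rfl⟩
  · refine .inl ⟨φ ⟨x, by simp⟩, φ ⟨y, by simp⟩, φ ⟨z, by simp⟩, ?_, ?_, ?_, hφ.2.forall.mpr ?_,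
      ?_, ?_, ?_⟩ <;>
    simp [hmult, hφ.1.eq_iff, hxy, hxz, hyz, hxy.symm, hxz.symm, hyz.symm]
  · refine .inr (.inl ⟨φ ⟨x, by simp⟩, φ ⟨y, by simp⟩, ?_, hφ.2.forall.mpr ?_, ?_, ?_⟩) <;>
    simp [hmult, hφ.1.eq_iff, hxy, hxy.symm]
  · refine .inr (.inr ⟨φ ⟨x, by simp⟩, hφ.2.forall.mpr ?_, ?_⟩) <;>
    simp [hmult, hφ.1.eq_iff]

end CardThree

section Cyclic

variable {s : TangentSection (planeToSpec k)} {T : Module.End k (LinearForm k)}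

theorem notMem_basicOpen_apply (hs : IsVectorFieldOf s T) {x : Plane k}
    (hx : x ∈ s.zeroIdeal.support) {l : LinearForm k}
    (hl : x ∉ Proj.basicOpen (grading k) l.1) : x ∉ Proj.basicOpen (grading k) (T l).1 := by
  obtain ⟨i, hi⟩ := exists_mem_chart (coordBasis k) x
  set e := coordBasis k i
  have hder : x ∉ (Plane k).basicOpen (s.der _ (ratio e l)) := by
    rw [Scheme.IdealSheafData.mem_support_iff_of_mem (U := chart (coordBasis k) i) hi] at hx
    exact (Scheme.mem_zeroLocus_iff _ _ _).mp hx _ (Ideal.subset_span ⟨_, rfl⟩)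
  have hsum : ratio e (T l) = s.der _ (ratio e l) + ratio e l * ratio e (T e) := by
    rw [hs e ((coordBasis k).ne_zero i), sub_add_cancel]
  rw [← mem_basicOpen_ratio hi] at hl ⊢
  rw [hsum]
  intro h
  rcases Scheme.basicOpen_add_le _ _ _ h with h | h
  · exact hder h
  · rw [Scheme.basicOpen_mul] at h
    exact hl h.1

theorem mem_chart_zero_of_cyclic (hs : IsVectorFieldOf s T)
    {b : Module.Basis (Fin 3) k (LinearForm k)} (hb₀ : T (b 0) = b 1) (hb₁ : T (b 1) = b 2)
    {x : Plane k} (hx : x ∈ s.zeroIdeal.support) : x ∈ (chart b 0).1 := by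
  by_contra h₀
  have h₁ : x ∉ (chart b 1).1 := by simpa only [hb₀] using notMem_basicOpen_apply hs hx h₀
  have h₂ : x ∉ (chart b 2).1 := by simpa only [hb₁] using notMem_basicOpen_apply hs hx h₁
  obtain ⟨i, hi⟩ := exists_mem_chart b x
  fin_cases i <;> contradiction

/-- The monic cubic `t³ - c₂ t² - c₁ t - c₀`, the characteristic polynomial of the companion
endomorphism `b₀ ↦ b₁ ↦ b₂ ↦ c₀ b₀ + c₁ b₁ + c₂ b₂`. -/
def companionCubic (c : Fin 3 → k) : Polynomial k :=
  Polynomial.X ^ 3 -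
    (Polynomial.C (c 0) + Polynomial.C (c 1) * Polynomial.X + Polynomial.C (c 2) * Polynomial.X ^ 2)

theorem natDegree_companionCubic (c : Fin 3 → k) : (companionCubic c).natDegree = 3 := by
  unfold companionCubic
  compute_degree!

theorem companionCubic_ne_zero (c : Fin 3 → k) : companionCubic c ≠ 0 :=
  Polynomial.ne_zero_of_natDegree_gt (n := 0) (by rw [natDegree_companionCubic]; norm_num)

theorem card_roots_companionCubic [IsAlgClosed k] (c : Fin 3 → k) :
    (companionCubic c).roots.card = 3 := by
  rw [← (IsAlgClosed.splits _).natDegree_eq_card_roots, natDegree_companionCubic]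

/-- The ideal of the zeros of the companion vector field on the chart with coordinates `u, v`. -/
def companionIdeal (c : Fin 3 → k) : Ideal (MvPolynomial (Fin 2) k) :=
  Ideal.span {X 1 - X 0 ^ 2, C (c 0) + C (c 1) * X 0 + C (c 2) * X 1 - X 1 * X 0}

/-- Restriction of a function of `u, v` to the parabola `u = t, v = t²`. -/
def evalParabola : MvPolynomial (Fin 2) k →ₐ[k] Polynomial k :=
  aeval ![Polynomial.X, Polynomial.X ^ 2]

@[simp]
theorem evalParabola_X_zero : evalParabola (k := k) (X 0) = Polynomial.X := by
  simp [evalParabola]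

@[simp]
theorem evalParabola_X_one : evalParabola (k := k) (X 1) = Polynomial.X ^ 2 := by
  simp [evalParabola]

theorem evalParabola_aeval (g : Polynomial k) :
    evalParabola (Polynomial.aeval (X 0) g) = g := by
  rw [← Polynomial.aeval_algHom_apply, evalParabola_X_zero, Polynomial.aeval_X_left_apply]

theorem companionIdeal_map_evalParabola (c : Fin 3 → k) :
    (companionIdeal c).map evalParabola = Ideal.span {companionCubic c} := by
  have h : evalParabola (C (c 0) + C (c 1) * X 0 + C (c 2) * X 1 - X 1 * X 0) =
      -companionCubic c := by
    have hC (a : k) : evalParabola (C a) = Polynomial.C a := evalParabola.commutes a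
    simp only [map_add, map_sub, map_mul, hC, evalParabola_X_zero, evalParabola_X_one,
      companionCubic]
    ring
  rw [companionIdeal, Ideal.map_span, Set.image_pair, h]
  simp [Ideal.span_insert, Ideal.span_singleton_neg]

theorem mk_aeval_evalParabola (c : Fin 3 → k) (q : MvPolynomial (Fin 2) k) :
    Ideal.Quotient.mk (companionIdeal c) (Polynomial.aeval (X 0) (evalParabola q)) =
      Ideal.Quotient.mk (companionIdeal c) q := by
  suffices h : ((Ideal.Quotient.mkₐ k (companionIdeal c)).comp (Polynomial.aeval (X 0))).comp
      evalParabola = Ideal.Quotient.mkₐ k (companionIdeal c) from congr($h q)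
  refine MvPolynomial.algHom_ext fun j => ?_
  fin_cases j
  · simp
  · have h : X 1 - X 0 ^ 2 ∈ companionIdeal c := Ideal.subset_span (Set.mem_insert _ _)
    simpa using (Ideal.Quotient.eq.mpr h).symm

/-- The zero scheme of the companion vector field is `Spec k[t] ⧸ (χ)`, with `χ` its companion
cubic: this is the quotient map from `k[t]`. -/
def companionMap (c : Fin 3 → k) :
    Polynomial k →+* MvPolynomial (Fin 2) k ⧸ companionIdeal c :=
  (Ideal.Quotient.mk _).comp (Polynomial.aeval (X 0)).toRingHom

theorem companionMap_surjective (c : Fin 3 → k) : Function.Surjective (companionMap c) := by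
  intro a
  obtain ⟨q, rfl⟩ := Ideal.Quotient.mk_surjective a
  exact ⟨evalParabola q, mk_aeval_evalParabola c q⟩

theorem ker_companionMap (c : Fin 3 → k) :
    RingHom.ker (companionMap c) = Ideal.span {companionCubic c} := by
  rw [← companionIdeal_map_evalParabola]
  apply le_antisymm
  · intro g hg
    rw [← evalParabola_aeval g]
    exact Ideal.mem_map_of_mem _ (Ideal.Quotient.eq_zero_iff_mem.mp hg)
  · rw [Ideal.map_le_iff_le_comap]
    intro q hq
    exact (mk_aeval_evalParabola c q).trans (Ideal.Quotient.eq_zero_iff_mem.mpr hq)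

theorem span_component_of_cyclic {b : Module.Basis (Fin 3) k (LinearForm k)}
    (hb₀ : T (b 0) = b 1) (hb₁ : T (b 1) = b 2) :
    Ideal.span (Set.range (component b T 0)) = companionIdeal ⇑(b.repr (T (b 2))) := by
  have haff₁ : affineCoord (k := k) 0 1 = X 0 := affineCoord_succAbove 0 0
  have haff₂ : affineCoord (k := k) 0 2 = X 1 := affineCoord_succAbove 0 1
  have h₀ : component b T 0 0 = 0 := by simp [component]
  have h₁ : component b T 0 1 = X 1 - X 0 ^ 2 := by
    rw [component, hb₀, hb₁, dehomogenize_basis, dehomogenize_basis, haff₁, haff₂, sq]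
  have h₂ : component b T 0 2 = C (b.repr (T (b 2)) 0) + C (b.repr (T (b 2)) 1) * X 0 +
      C (b.repr (T (b 2)) 2) * X 1 - X 1 * X 0 := by
    rw [component, hb₀, dehomogenize_basis, haff₁, haff₂, dehomogenize_coe,
      b.constr_apply_fintype k, Fin.sum_univ_three, haff₁, haff₂, affineCoord_same]
    simp [smul_eq_C_mul]
  have hrange : Set.range (component b T 0) =
      {component b T 0 0, component b T 0 1, component b T 0 2} := by
    ext p
    simp [Fin.exists_fin_succ, eq_comm]
  rw [hrange, h₀, Ideal.span_insert_zero, h₁, h₂, companionIdeal]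

theorem points_of_cyclic [IsAlgClosed k] (hs : IsVectorFieldOf s T)
    {b : Module.Basis (Fin 3) k (LinearForm k)} (hb₀ : T (b 0) = b 1) (hb₁ : T (b 1) = b 2) :
    IsThreePoints s.zeroScheme ∨ IsDoubleAndSimplePoint s.zeroScheme ∨
      IsTriplePoint s.zeroScheme := by
  classical
  set c := ⇑(b.repr (T (b 2)))
  have hideal : s.zeroIdeal.ideal (chart b 0) = (companionIdeal c).map (chartIso b 0) := by
    rw [zeroIdeal_chart hs, span_component_of_cyclic hb₀ hb₁]
  let e := Ideal.quotientEquiv _ _ (chartIso b 0) hideal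
  have hU (x : s.zeroIdeal.subscheme) : s.zeroIdeal.subschemeι x ∈ (chart b 0).1 := by
    refine mem_chart_zero_of_cyclic hs hb₀ hb₁ ?_
    exact s.zeroIdeal.range_subschemeι.subset (Set.mem_range_self x)
  have hker : RingHom.ker (e.toRingHom.comp (companionMap c)) = Ideal.span {companionCubic c} :=
    (RingHom.ker_equiv_comp _ e).trans (ker_companionMap c)
  obtain ⟨φ, hφ, hmult⟩ := exists_bijective_roots s.zeroIdeal (chart b 0) hU
    (e.surjective.comp (companionMap_surjective c)) hker (companionCubic_ne_zero c)
  exact points_of_bijective_multiset (card_roots_companionCubic c) hφ fun a => by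
    rw [Polynomial.count_roots]
    exact hmult a

end Cyclic

section CoveringIdeals

variable {R : Type*} [CommRing R] {v f : R} {J M : Ideal R}

theorem mul_mem_span_singleton_mul_iff (hv : v ∈ nonZeroDivisors R) {r : R} :
    r * v ∈ Ideal.span {v} * M ↔ r ∈ M := by
  rw [Ideal.mem_span_singleton_mul]
  refine ⟨fun ⟨z, hz, h⟩ => ?_, fun h => ⟨r, h, mul_comm v r⟩⟩
  rw [mul_comm v z, mul_cancel_right_mem_nonZeroDivisors hv] at h
  exact h ▸ hz

theorem span_singleton_mul_covBy (hv : v ∈ nonZeroDivisors R) (hM : M.IsMaximal) :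
    Ideal.span {v} * M ⋖ Ideal.span {v} := by
  refine ⟨lt_of_le_not_ge Ideal.mul_le_left fun h => ?_, fun K hK hKv => hKv.not_ge ?_⟩
  · have hvM : 1 * v ∈ Ideal.span {v} * M := by
      simpa only [one_mul] using h (Ideal.mem_span_singleton_self v)
    exact hM.ne_top ((Ideal.eq_top_iff_one M).mpr ((mul_mem_span_singleton_mul_iff hv).mp hvM))
  · obtain ⟨c, hcK, hc⟩ := SetLike.exists_of_lt hK
    obtain ⟨r, rfl⟩ := Ideal.mem_span_singleton'.mp (hKv.le hcK)
    obtain ⟨t, m, hm, htm⟩ := hM.exists_inv fun hr =>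
      hc ((mul_mem_span_singleton_mul_iff hv).mpr hr)
    have hvK : v = t * (r * v) + m * v := by linear_combination -v * htm
    rw [Ideal.span_singleton_le_iff_mem, hvK]
    exact add_mem (Ideal.mul_mem_left _ _ hcK)
      (hK.le ((mul_mem_span_singleton_mul_iff hv).mpr hm))

theorem le_of_map_away_le {S : Type*} [CommRing S] [Algebra R S] [IsLocalization.Away f S]
    (hM : M.IsMaximal) (hf : f ∉ M) {K L : Ideal R} (hL : L * M ≤ K)
    (h : L.map (algebraMap R S) ≤ K.map (algebraMap R S)) : L ≤ K := by
  intro a ha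
  obtain ⟨_, ⟨n, rfl⟩, hn⟩ := (IsLocalization.algebraMap_mem_map_algebraMap_iff
    (Submonoid.powers f) S K a).mp (h (Ideal.mem_map_of_mem _ ha))
  obtain ⟨t, m, hm, htm⟩ := hM.exists_inv fun hfn => hf (hM.isPrime.mem_of_pow_mem n hfn)
  have haK : a = t * (f ^ n * a) + a * m := by linear_combination -a * htm
  rw [haK]
  exact add_mem (Ideal.mul_mem_left _ _ hn) (hL (Ideal.mul_mem_mul ha hm))

theorem mul_covBy_of_map_away_covBy {S : Type*} [CommRing S] [Algebra R S]
    [IsLocalization.Away f S] (hM : M.IsMaximal) (hf : f ∉ M)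
    (h : (J * M).map (algebraMap R S) ⋖ J.map (algebraMap R S)) : J * M ⋖ J := by
  have hle {K L : Ideal R} (hK : J * M ≤ K) (hL : L ≤ J) :=
    le_of_map_away_le (S := S) hM hf ((Ideal.mul_mono_left hL).trans hK)
  refine ⟨lt_of_le_of_ne Ideal.mul_le_left fun h' => h.ne (by rw [h']), fun K hK hKJ => ?_⟩
  rcases h.eq_or_eq (Ideal.map_mono hK.le) (Ideal.map_mono hKJ.le) with h' | h'
  · exact hK.not_ge (hle le_rfl hKJ.le h'.le)
  · exact hKJ.not_ge (hle hK.le le_rfl h'.ge)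

theorem length_quotient_eq_one_of_covBy {I : Ideal R} (h : I ⋖ J) :
    Module.length R (J ⧸ I.submoduleOf J) = 1 :=
  Module.length_eq_one_iff.mpr ((covBy_iff_quot_is_simple h.le).mp h)

theorem map_mk_mem_associatedPrimes (hv : v ∈ nonZeroDivisors R) (hM : M.IsPrime) :
    M.map (Ideal.Quotient.mk (Ideal.span {v} * M)) ∈
      associatedPrimes (R ⧸ Ideal.span {v} * M) (R ⧸ Ideal.span {v} * M) := by
  set π := Ideal.Quotient.mk (Ideal.span {v} * M)
  have hprime : (M.map π).IsPrime := by
    refine Ideal.map_isPrime_of_surjective Ideal.Quotient.mk_surjective ?_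
    rw [Ideal.mk_ker]
    exact Ideal.mul_le_right
  refine ⟨hprime, π v, ?_⟩
  suffices h : Submodule.colon (⊥ : Ideal (R ⧸ Ideal.span {v} * M)) {π v} = M.map π by
    rw [h, hprime.radical]
  ext a
  obtain ⟨r, rfl⟩ := Ideal.Quotient.mk_surjective a
  rw [Submodule.mem_colon_singleton, Submodule.mem_bot, smul_eq_mul, ← map_mul,
    Ideal.Quotient.eq_zero_iff_mem, mul_mem_span_singleton_mul_iff hv,
    Ideal.mem_quotient_iff_mem Ideal.mul_le_right]

theorem notMem_minimalPrimes_of_lt {I : Ideal R} (hJ : J.IsPrime) (hIJ : I ≤ J) (h : J < M) :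
    M.map (Ideal.Quotient.mk I) ∉ minimalPrimes (R ⧸ I) := by
  intro hmin
  have hM : M ∈ I.minimalPrimes := by
    rw [Ideal.minimalPrimes_eq_comap]
    exact ⟨_, hmin, Ideal.comap_map_mk (hIJ.trans h.le)⟩
  exact h.not_ge (hM.2 ⟨hJ, hIJ⟩ h.le)

end CoveringIdeals

section ReducedSubschemes

variable {X : Scheme.{u}} (U : X.affineOpens)

theorem vanishingIdeal_ideal_eq (Z : Closeds X) {J : Ideal Γ(X, U.1)} (hJ : J.IsRadical)
    (h : ∀ x ∈ U.1, x ∈ Z ↔ x ∈ X.zeroLocus (U := U.1) (J : Set Γ(X, U.1))) :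
    (Scheme.IdealSheafData.vanishingIdeal Z).ideal U = J := by
  have hpre : U.2.fromSpec ⁻¹' (Z : Set X) = PrimeSpectrum.zeroLocus (J : Set Γ(X, U.1)) := by
    rw [← U.2.fromSpec_preimage_zeroLocus]
    ext y
    exact h _ (U.2.range_fromSpec.subset (Set.mem_range_self y))
  refine (congrArg PrimeSpectrum.vanishingIdeal hpre).trans ?_
  rw [PrimeSpectrum.vanishingIdeal_zeroLocus_eq_radical, hJ.radical]

theorem vanishingIdeal_ideal_eq_top {Z : Closeds X} (h : ∀ x ∈ U.1, x ∉ Z) :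
    (Scheme.IdealSheafData.vanishingIdeal Z).ideal U = ⊤ := by
  refine vanishingIdeal_ideal_eq U Z (Ideal.radical_eq_iff.mp (Ideal.radical_top _))
    fun x hx => iff_of_false (h x hx) fun hx' => ?_
  rw [Scheme.mem_zeroLocus_iff] at hx'
  exact hx' 1 trivial (by simpa using hx)

theorem exists_support_eq_singleton {I : X.IdealSheafData} (hU : ∀ x ∈ I.support, x ∈ U.1)
    (hI : (I.ideal U).IsMaximal) : ∃ p, (I.support : Set X) = {p} := by
  refine ⟨U.2.fromSpec ⟨I.ideal U, hI.isPrime⟩, ?_⟩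
  rw [← Set.inter_eq_left.mpr hU, I.coe_support_inter U, ← U.2.fromSpec_image_zeroLocus,
    PrimeSpectrum.zeroLocus_eq_singleton]
  exact Set.image_singleton

/-- The ideal sheaf of a closed point with its reduced structure. -/
abbrev pointIdeal {p : X} (hp : IsClosed ({p} : Set X)) : X.IdealSheafData :=
  Scheme.IdealSheafData.vanishingIdeal ⟨{p}, hp⟩

variable {p : X} (hp : IsClosed ({p} : Set X))

theorem exists_pointIdeal_eq (hpU : p ∈ U.1) :
    ∃ y : PrimeSpectrum Γ(X, U.1), U.2.fromSpec y = p ∧ (pointIdeal hp).ideal U = y.asIdeal := by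
  have hU : IsAffineOpen U.1 := U.2
  obtain ⟨y, rfl⟩ := hU.range_fromSpec.superset hpU
  refine ⟨y, rfl, ?_⟩
  have hpre : hU.fromSpec ⁻¹' {hU.fromSpec y} = {y} :=
    Set.ext fun z => hU.fromSpec.isOpenEmbedding.injective.eq_iff
  refine (congrArg PrimeSpectrum.vanishingIdeal hpre).trans ?_
  exact PrimeSpectrum.vanishingIdeal_singleton y

theorem isMaximal_pointIdeal (hpU : p ∈ U.1) : ((pointIdeal hp).ideal U).IsMaximal := by
  have hU : IsAffineOpen U.1 := U.2
  obtain ⟨y, hyp, hy⟩ := exists_pointIdeal_eq U hp hpU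
  rw [hy, ← PrimeSpectrum.isClosed_singleton_iff_isMaximal]
  have hpre : hU.fromSpec ⁻¹' {p} = {y} :=
    Set.ext fun z => hyp ▸ hU.fromSpec.isOpenEmbedding.injective.eq_iff
  exact hpre ▸ hp.preimage hU.fromSpec.continuous

end ReducedSubschemes

section EmbeddedPoints

variable {X : Scheme.{u}}

open Module.associatedPrimes in
theorem maximalIdeal_isEmbedded {B : Type*} [CommRing B] (S : Type*) [CommRing S] [IsLocalRing S]
    [Algebra B S] (P : Ideal B) [P.IsPrime] [IsLocalization.AtPrime S P]
    (hass : P ∈ associatedPrimes B B) (hmin : P ∉ minimalPrimes B) :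
    IsLocalRing.maximalIdeal S ∈ associatedPrimes S S ∧
      IsLocalRing.maximalIdeal S ∉ minimalPrimes S := by
  have hP : (IsLocalRing.maximalIdeal S).under B = P :=
    IsLocalization.AtPrime.under_maximalIdeal S P
  constructor
  · refine mem_associatedPrimes_of_comap_mem_associatedPrimes_of_isLocalizedModule
      P.primeCompl (Algebra.linearMap B S) _ ?_
    rwa [← Ideal.under_def, hP]
  · have hmap := IsLocalization.minimalPrimes_map P.primeCompl S ⊥
    rw [Ideal.map_bot] at hmap
    exact fun h => hmin (hP ▸ hmap.subset h)

theorem isEmbeddedPoint_of_mem_associatedPrimes (I : X.IdealSheafData) (U : X.affineOpens)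
    (y : PrimeSpectrum (Γ(X, U.1) ⧸ I.ideal U))
    (hass : y.asIdeal ∈ associatedPrimes (Γ(X, U.1) ⧸ I.ideal U) (Γ(X, U.1) ⧸ I.ideal U))
    (hmin : y.asIdeal ∉ minimalPrimes (Γ(X, U.1) ⧸ I.ideal U)) :
    IsEmbeddedPoint I.subscheme (I.subschemeCover.f U y) := by
  let := ((stalkEquiv I U y).symm.toRingHom.comp (algebraMap (Γ(X, U.1) ⧸ I.ideal U)
    (Localization.AtPrime y.asIdeal))).toAlgebra
  have : IsLocalization.AtPrime (I.subscheme.presheaf.stalk (I.subschemeCover.f U y)) y.asIdeal :=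
    (IsLocalization.isLocalization_iff_of_ringEquiv y.asIdeal.primeCompl
      (stalkEquiv I U y).symm).mp inferInstance
  exact maximalIdeal_isEmbedded _ y.asIdeal hass hmin

theorem subschemeι_subschemeCover (I : X.IdealSheafData) (U : X.affineOpens)
    (y : PrimeSpectrum (Γ(X, U.1) ⧸ I.ideal U)) :
    I.subschemeι (I.subschemeCover.f U y) =
      U.2.fromSpec (PrimeSpectrum.comap (Ideal.Quotient.mk (I.ideal U)) y) := by
  have h := I.subschemeCover_map_subschemeι U
  rw [I.glueDataObjι_ι] at h
  exact congr($h y)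

theorem exists_isEmbeddedPoint {I : X.IdealSheafData} {U : X.affineOpens} {p : X}
    (hp : IsClosed ({p} : Set X)) (hpU : p ∈ U.1) {v : Γ(X, U.1)} (hv : v ∈ nonZeroDivisors _)
    (hI : I.ideal U = Ideal.span {v} * (pointIdeal hp).ideal U)
    (hprime : (Ideal.span {v}).IsPrime) (hlt : Ideal.span {v} < (pointIdeal hp).ideal U) :
    ∃ x, I.subschemeι x = p ∧ IsEmbeddedPoint I.subscheme x := by
  obtain ⟨y, hyp, hy⟩ := exists_pointIdeal_eq U hp hpU
  rw [hy] at hI hlt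
  have hass := map_mk_mem_associatedPrimes hv y.2
  have hmin := notMem_minimalPrimes_of_lt hprime (I := Ideal.span {v} * y.asIdeal)
    Ideal.mul_le_left hlt
  rw [← hI] at hass hmin
  refine ⟨I.subschemeCover.f U ⟨_, hass.1⟩, ?_,
    isEmbeddedPoint_of_mem_associatedPrimes I U _ hass hmin⟩
  have hIy : I.ideal U ≤ y.asIdeal := hI.le.trans Ideal.mul_le_right
  refine (subschemeι_subschemeCover I U _).trans ((congrArg U.2.fromSpec ?_).trans hyp)
  exact PrimeSpectrum.ext (Ideal.comap_map_mk hIy)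

theorem exists_ideal_affineBasicOpen_eq_span {J : X.IdealSheafData} {U : X.affineOpens}
    (g : Γ(X, U.1)) {v : Γ(X, U.1)} (hv : v ∈ nonZeroDivisors _)
    (hJ : J.ideal U = Ideal.span {v}) :
    ∃ w ∈ nonZeroDivisors Γ(X, (X.affineBasicOpen g).1),
      J.ideal (X.affineBasicOpen g) = Ideal.span {w} := by
  let := (X.presheaf.map (homOfLE (X.basicOpen_le g)).op).hom.toAlgebra
  have : IsLocalization.Away g Γ(X, X.basicOpen g) := U.2.isLocalization_of_eq_basicOpen _ _ rfl
  refine ⟨algebraMap Γ(X, U.1) Γ(X, X.basicOpen g) v,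
    IsLocalization.nonZeroDivisors_le_comap (.powers g) Γ(X, X.basicOpen g) hv, ?_⟩
  have hmap := J.map_ideal_basicOpen U g
  rw [hJ, Ideal.map_span, Set.image_singleton] at hmap
  exact hmap.symm

/-- Near `p`, where `J` is generated by a non-zero-divisor `v`, multiplication by `v` identifies
`𝒪 / I_p` with `J / J I_p`. -/
theorem mul_pointIdeal_covBy (J : X.IdealSheafData) {p : X} (hp : IsClosed ({p} : Set X))
    {U₀ U : X.affineOpens} (hp₀ : p ∈ U₀.1) (hpU : p ∈ U.1) {v : Γ(X, U₀.1)}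
    (hv : v ∈ nonZeroDivisors _) (hJ : J.ideal U₀ = Ideal.span {v}) :
    J.ideal U * (pointIdeal hp).ideal U ⋖ J.ideal U := by
  obtain ⟨f, g, hfg, hpf⟩ := exists_basicOpen_le_affine_inter U.2 U₀.2 p ⟨hpU, hp₀⟩
  have hD : X.affineBasicOpen f = X.affineBasicOpen g := Subtype.ext hfg
  let := (X.presheaf.map (homOfLE (X.basicOpen_le f)).op).hom.toAlgebra
  have : IsLocalization.Away f Γ(X, X.basicOpen f) := U.2.isLocalization_of_eq_basicOpen _ _ rfl
  have hmap (K : X.IdealSheafData) : (K.ideal U).map (algebraMap Γ(X, U.1) Γ(X, X.basicOpen f)) =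
    K.ideal (X.affineBasicOpen f) := K.map_ideal_basicOpen U f
  have hM := isMaximal_pointIdeal (X.affineBasicOpen f) hp hpf
  refine mul_covBy_of_map_away_covBy (f := f) (S := Γ(X, X.basicOpen f))
    (isMaximal_pointIdeal U hp hpU) (fun hf => hM.ne_top ?_) ?_
  · rw [← hmap]
    exact Ideal.eq_top_of_isUnit_mem _ (Ideal.mem_map_of_mem _ hf)
      (IsLocalization.Away.algebraMap_isUnit f)
  · rw [Ideal.map_mul, hmap, hmap]
    obtain ⟨w, hw, hJw⟩ : ∃ w ∈ nonZeroDivisors Γ(X, (X.affineBasicOpen f).1),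
        J.ideal (X.affineBasicOpen f) = Ideal.span {w} := by
      rw [hD]
      exact exists_ideal_affineBasicOpen_eq_span g hv hJ
    rw [hJw]
    exact span_singleton_mul_covBy hw hM

end EmbeddedPoints

section CoordinateIdeals

variable {n : Fin 3} {S S' : Set (Fin 3)}

theorem affineCoord_image_eq (hn : n ∉ S) :
    affineCoord (k := k) n '' S = X '' (n.succAbove ⁻¹' S) := by
  have hS : S ⊆ Set.range n.succAbove := by
    rw [Fin.range_succAbove]
    exact Set.subset_compl_singleton_iff.mpr hn
  conv_lhs => rw [← Set.image_preimage_eq_of_subset hS, Set.image_image]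
  simp only [affineCoord_succAbove]

theorem span_affineCoord_image_eq_top (hn : n ∈ S) :
    Ideal.span (affineCoord (k := k) n '' S) = ⊤ :=
  (Ideal.eq_top_iff_one _).mpr (Ideal.subset_span ⟨n, hn, affineCoord_same n⟩)

theorem isPrime_span_affineCoord_image (hn : n ∉ S) :
    (Ideal.span (affineCoord (k := k) n '' S)).IsPrime := by
  rw [affineCoord_image_eq hn]
  exact isPrime_span_X_image _

theorem isMaximal_idealOfVars (σ : Type*) : (idealOfVars σ k).IsMaximal := by
  have hker : idealOfVars σ k = RingHom.ker constantCoeff := by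
    ext p
    rw [← pow_one (idealOfVars σ k), mem_pow_idealOfVars_iff', RingHom.mem_ker, constantCoeff_eq]
    simp [Finsupp.degree_eq_zero_iff]
  rw [hker]
  exact RingHom.ker_isMaximal_of_surjective _ fun c => ⟨C c, constantCoeff_C _ c⟩

theorem isMaximal_span_affineCoord_image_compl (n : Fin 3) :
    (Ideal.span (affineCoord (k := k) n '' {n}ᶜ)).IsMaximal := by
  have himage : affineCoord (k := k) n '' {n}ᶜ = Set.range X := by
    rw [← Fin.range_succAbove, ← Set.range_comp]
    exact congrArg Set.range (funext (affineCoord_succAbove n))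
  exact himage ▸ isMaximal_idealOfVars (Fin 2)

theorem span_affineCoord_image_lt (hn : n ∉ S') (h : S ⊂ S') :
    Ideal.span (affineCoord (k := k) n '' S) < Ideal.span (affineCoord n '' S') := by
  obtain ⟨hle, m, hm', hm⟩ := Set.ssubset_iff_exists.mp h
  refine lt_of_le_of_ne (Ideal.span_mono (Set.image_mono hle)) fun heq => ?_
  have hmem : affineCoord (k := k) n m ∈ Ideal.span (affineCoord n '' S) :=
    heq ▸ Ideal.subset_span ⟨m, hm', rfl⟩
  obtain ⟨j, rfl⟩ := Fin.exists_succAbove_eq fun hmn : m = n => hn (hmn ▸ hm')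
  rw [affineCoord_image_eq fun h => hn (hle h), affineCoord_succAbove] at hmem
  exact X_notMem_span_X_image (s := n.succAbove ⁻¹' S) hm hmem

end CoordinateIdeals

section CoordinateSubspaces

variable (b : Module.Basis (Fin 3) k (LinearForm k)) (S S' : Set (Fin 3)) (n : Fin 3)

/-- The linear subspace of the plane where the linear forms `b m`, `m ∈ S`, of a basis vanish. -/
def coordinateSubspace : Closeds (Plane k) :=
  ⟨{x | ∀ m ∈ S, x ∉ (chart b m).1}, by
    simp only [Set.ofPred_forall]
    exact isClosed_biInter fun m _ => (chart b m).1.isOpen.isClosed_compl⟩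

variable {b S} in
theorem mem_coordinateSubspace {x : Plane k} :
    x ∈ coordinateSubspace b S ↔ ∀ m ∈ S, x ∉ (chart b m).1 := Iff.rfl

theorem coordinateSubspace_singleton (i : Fin 3) :
    coordinateSubspace b {i} = zeroSet (b i).1 := by
  ext x
  refine forall_eq.trans ?_
  rw [Proj.mem_basicOpen, not_not]
  exact Set.singleton_subset_iff.symm

theorem isLine_coordinateSubspace (i : Fin 3) : IsLine (coordinateSubspace b {i}) :=
  ⟨(b i).1, (b i).2, Subtype.coe_ne_coe.mpr (b.ne_zero i), coordinateSubspace_singleton b i⟩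

theorem vanishingIdeal_coordinateSubspace :
    (Scheme.IdealSheafData.vanishingIdeal (coordinateSubspace b S)).ideal (chart b n) =
      (Ideal.span (affineCoord n '' S)).map (chartIso b n) := by
  apply vanishingIdeal_ideal_eq
  · by_cases hn : n ∈ S
    · rw [span_affineCoord_image_eq_top hn, Ideal.map_top]
      exact Ideal.radical_eq_iff.mp (Ideal.radical_top _)
    · have := isPrime_span_affineCoord_image (k := k) hn
      exact (Ideal.map_isPrime_of_equiv (chartIso b n)
        (I := Ideal.span (affineCoord n '' S))).isRadical
  · intro x hx
    rw [mem_coordinateSubspace, Ideal.map_span, Scheme.zeroLocus_span, Scheme.mem_zeroLocus_iff]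
    simp only [Set.forall_mem_image]
    refine forall₂_congr fun m _ => not_congr ?_
    rw [← mem_basicOpen_ratio hx, ← chartMap_affineCoord]
    rfl

theorem vanishingIdeal_coordinateSubspace_mul_eq_inf (h : S ∪ S' = Set.univ) :
    Scheme.IdealSheafData.vanishingIdeal (coordinateSubspace b S) *
        Scheme.IdealSheafData.vanishingIdeal (coordinateSubspace b S') =
      Scheme.IdealSheafData.vanishingIdeal (coordinateSubspace b S) ⊓
        Scheme.IdealSheafData.vanishingIdeal (coordinateSubspace b S') := by
  refine Scheme.IdealSheafData.ext_of_iSup_eq_top _ (iSup_chart b) fun n => ?_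
  refine Ideal.mul_eq_inf_of_coprime ?_
  rw [vanishingIdeal_coordinateSubspace, vanishingIdeal_coordinateSubspace, ← Ideal.map_sup,
    ← Ideal.span_union, ← Set.image_union, h, span_affineCoord_image_eq_top (Set.mem_univ n),
    Ideal.map_top]

theorem coordinateSubspace_compl_subset_chart {x : Plane k} (hx : x ∈ coordinateSubspace b {n}ᶜ) :
    x ∈ (chart b n).1 := by
  obtain ⟨m, hm⟩ := exists_mem_chart b x
  have hmn : m = n := by_contra fun hmn => hx m hmn hm
  exact hmn ▸ hm

theorem exists_coordinateSubspace_compl_eq :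
    ∃ (p : Plane k) (hp : IsClosed {p}), coordinateSubspace b {n}ᶜ = ⟨{p}, hp⟩ := by
  set Z := coordinateSubspace b {n}ᶜ
  obtain ⟨p, hp⟩ := exists_support_eq_singleton (chart b n)
    (I := Scheme.IdealSheafData.vanishingIdeal Z)
    (fun x hx => coordinateSubspace_compl_subset_chart b n hx) (by
      rw [vanishingIdeal_coordinateSubspace]
      have := isMaximal_span_affineCoord_image_compl (k := k) n
      exact Ideal.map_isMaximal_of_equiv (chartIso b n))
  have hZ : (Z : Set (Plane k)) = {p} := hp
  exact ⟨p, hZ ▸ Z.isClosed, SetLike.coe_injective hZ⟩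

end CoordinateSubspaces

section RankOne

open scoped Pointwise

variable {s : TangentSection (planeToSpec k)} {T : Module.End k (LinearForm k)}
  {b : Module.Basis (Fin 3) k (LinearForm k)} {x c : k} {i : Fin 3}

theorem component_of_scalar_add_rank_one {a : Fin 3 → k}
    (hT : ∀ m, T (b m) = x • b m + a m • b i) (n m : Fin 3) :
    component b T n m = affineCoord n i * (C (a m) - C (a n) * affineCoord n m) := by
  have hdehom (j : Fin 3) : dehomogenize b n (T (b j)).1 =
      C x * affineCoord n j + C (a j) * affineCoord n i := by
    rw [hT, Submodule.coe_add, Submodule.coe_smul, Submodule.coe_smul, map_add, map_smul, map_smul,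
      dehomogenize_basis, dehomogenize_basis, smul_eq_C_mul, smul_eq_C_mul]
  rw [component, hdehom, hdehom, affineCoord_same]
  ring

theorem span_range_C_sub_C_mul_affineCoord {a : Fin 3 → k} {l : Fin 3} (hl : a l ≠ 0)
    (ha : ∀ m ≠ l, a m = 0) (n : Fin 3) :
    Ideal.span (Set.range fun m => C (a m) - C (a n) * affineCoord n m) =
      Ideal.span (affineCoord n '' {l}ᶜ) := by
  have hunit : IsUnit (C (a l) : MvPolynomial (Fin 2) k) := hl.isUnit.map C
  by_cases hn : n = l
  · subst hn
    apply le_antisymm <;> rw [Ideal.span_le]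
    · rintro _ ⟨m, rfl⟩
      by_cases hm : m = n
      · simp [hm]
      · have hmem : C (a n) * affineCoord n m ∈ Ideal.span (affineCoord n '' {n}ᶜ) :=
          Ideal.mul_mem_left _ _ (Ideal.subset_span (Set.mem_image_of_mem (affineCoord n) hm))
        simpa [ha m hm] using hmem
    · rintro _ ⟨m, hm, rfl⟩
      refine (Ideal.unit_mul_mem_iff_mem _ hunit).mp (neg_mem_iff.mp (Ideal.subset_span ⟨m, ?_⟩))
      simp [ha m hm]
  · rw [span_affineCoord_image_eq_top (Set.mem_compl_singleton_iff.mpr hn)]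
    exact Ideal.eq_top_of_isUnit_mem _ (Ideal.subset_span ⟨l, by simp [ha n hn]⟩) hunit

theorem zeroIdeal_eq_mul_of_scalar_add_rank_one (hs : IsVectorFieldOf s T) {a : Fin 3 → k}
    {l : Fin 3} (hl : a l ≠ 0) (ha : ∀ m ≠ l, a m = 0)
    (hT : ∀ m, T (b m) = x • b m + a m • b i) :
    s.zeroIdeal = Scheme.IdealSheafData.vanishingIdeal (coordinateSubspace b {i}) *
      Scheme.IdealSheafData.vanishingIdeal (coordinateSubspace b {l}ᶜ) := by
  refine Scheme.IdealSheafData.ext_of_iSup_eq_top _ (iSup_chart b) fun n => ?_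
  have hrange : Set.range (component b T n) =
      {affineCoord (k := k) n i} * Set.range fun m => C (a m) - C (a n) * affineCoord n m := by
    rw [Set.singleton_mul, ← Set.range_comp]
    exact congrArg Set.range (funext (component_of_scalar_add_rank_one hT n))
  rw [zeroIdeal_chart hs, hrange, ← Ideal.span_mul_span', span_range_C_sub_C_mul_affineCoord hl ha,
    Ideal.map_mul, ← Set.image_singleton, ← vanishingIdeal_coordinateSubspace,
    ← vanishingIdeal_coordinateSubspace]
  rfl

end RankOne

section Types

variable (b : Module.Basis (Fin 3) k (LinearForm k)) {i l : Fin 3}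

theorem isLineUnionPoint_mul_vanishingIdeal (l : Fin 3) :
    IsLineUnionPoint (Scheme.IdealSheafData.vanishingIdeal (coordinateSubspace b {l}) *
      Scheme.IdealSheafData.vanishingIdeal (coordinateSubspace b {l}ᶜ)) := by
  obtain ⟨p, hp, hZ⟩ := exists_coordinateSubspace_compl_eq b l
  have hpZ : p ∈ coordinateSubspace b {l}ᶜ := hZ ▸ Set.mem_singleton p
  refine ⟨coordinateSubspace b {l}, p, hp, isLine_coordinateSubspace b l, fun hpL => ?_, ?_⟩
  · exact hpL l rfl (coordinateSubspace_compl_subset_chart b l hpZ)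
  · rw [vanishingIdeal_coordinateSubspace_mul_eq_inf b _ _ (Set.union_compl_self _), hZ]

theorem vanishingIdeal_coordinateSubspace_singleton (n : Fin 3) :
    (Scheme.IdealSheafData.vanishingIdeal (coordinateSubspace b {i})).ideal (chart b n) =
      Ideal.span {chartIso b n (affineCoord n i)} := by
  rw [vanishingIdeal_coordinateSubspace, Set.image_singleton, Ideal.map_span, Set.image_singleton]

theorem chartIso_affineCoord_mem_nonZeroDivisors (h : i ≠ l) :
    chartIso b l (affineCoord l i) ∈ nonZeroDivisors Γ(Plane k, (chart b l).1) := by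
  have : IsDomain Γ(Plane k, (chart b l).1) := (chartIso b l).symm.toMulEquiv.isDomain _
  obtain ⟨j, rfl⟩ := Fin.exists_succAbove_eq h
  rw [affineCoord_succAbove]
  exact mem_nonZeroDivisors_of_ne_zero
    ((map_ne_zero_iff _ (chartIso b l).injective).mpr (X_ne_zero j))

theorem vanishingIdeal_coordinateSubspace_lt {S S' : Set (Fin 3)} (hl : l ∉ S') (h : S ⊂ S') :
    (Scheme.IdealSheafData.vanishingIdeal (coordinateSubspace b S)).ideal (chart b l) <
      (Scheme.IdealSheafData.vanishingIdeal (coordinateSubspace b S')).ideal (chart b l) := by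
  rw [vanishingIdeal_coordinateSubspace, vanishingIdeal_coordinateSubspace]
  exact (chartIso b l).idealComapOrderIso.symm.strictMono (span_affineCoord_image_lt hl h)

theorem isLineWithEmbeddedPoint_mul_vanishingIdeal (h : i ≠ l) :
    IsLineWithEmbeddedPoint (Scheme.IdealSheafData.vanishingIdeal (coordinateSubspace b {i}) *
      Scheme.IdealSheafData.vanishingIdeal (coordinateSubspace b {l}ᶜ)) := by
  obtain ⟨p, hp, hZ⟩ := exists_coordinateSubspace_compl_eq b l
  have hpZ : p ∈ coordinateSubspace b {l}ᶜ := hZ ▸ Set.mem_singleton p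
  have hpl : p ∈ (chart b l).1 := coordinateSubspace_compl_subset_chart b l hpZ
  have hJ := vanishingIdeal_coordinateSubspace_singleton b (i := i) l
  have hv := chartIso_affineCoord_mem_nonZeroDivisors b h
  have hsub : ({i} : Set (Fin 3)) ⊂ {l}ᶜ := by
    obtain ⟨m, hmi, hml⟩ : ∃ m : Fin 3, m ≠ i ∧ m ≠ l :=
      Fin.exists_ne_and_ne_of_two_lt i l (by decide)
    exact Set.ssubset_iff_exists.mpr ⟨Set.singleton_subset_iff.mpr h, m, hml, hmi⟩
  have hprime : (Ideal.span {chartIso b l (affineCoord l i)}).IsPrime := by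
    have := isPrime_span_affineCoord_image (k := k) (Set.mem_singleton_iff.not.mpr h.symm)
    rw [← hJ, vanishingIdeal_coordinateSubspace]
    exact Ideal.map_isPrime_of_equiv (chartIso b l)
  have hlt := vanishingIdeal_coordinateSubspace_lt b (Set.notMem_compl_iff.mpr
    (Set.mem_singleton l)) hsub
  rw [hJ, hZ] at hlt
  rw [hZ]
  refine ⟨coordinateSubspace b {i}, p, isLine_coordinateSubspace b i, hp,
    fun m hm => hpZ m (hsub.le hm), fun U => Ideal.mul_le_left, fun U hpU => ?_,
    exists_isEmbeddedPoint hp hpl hv (congrArg (· * _) hJ) hprime hlt, fun U hpU =>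
    length_quotient_eq_one_of_covBy (mul_pointIdeal_covBy _ hp hpl hpU hv hJ)⟩
  have htop : (pointIdeal hp).ideal U = ⊤ :=
    vanishingIdeal_ideal_eq_top U fun x hx hxp => hpU (Set.mem_singleton_iff.mp hxp ▸ hx)
  exact (congrArg (_ * ·) htop).trans (Ideal.mul_top _)

theorem line_of_scalar_add_rank_one {s : TangentSection (planeToSpec k)}
    {T : Module.End k (LinearForm k)} {x : k} {a : Fin 3 → k} (hs : IsVectorFieldOf s T)
    (hl : a l ≠ 0) (ha : ∀ m ≠ l, a m = 0) (hT : ∀ m, T (b m) = x • b m + a m • b i) :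
    IsLineUnionPoint s.zeroIdeal ∨ IsLineWithEmbeddedPoint s.zeroIdeal := by
  rw [zeroIdeal_eq_mul_of_scalar_add_rank_one hs hl ha hT]
  rcases eq_or_ne i l with rfl | h
  · exact .inl (isLineUnionPoint_mul_vanishingIdeal b i)
  · exact .inr (isLineWithEmbeddedPoint_mul_vanishingIdeal b h)

end Types

end PlaneTangent

end

open PlaneTangent in
theorem theorem2 {k : Type u} [Field k] [IsAlgClosed k]
    (s : TangentSection (planeToSpec k)) (hs : s ≠ 0) :
    IsThreePoints s.zeroScheme ∨
      IsDoubleAndSimplePoint s.zeroScheme ∨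
      IsTriplePoint s.zeroScheme ∨
      IsLineUnionPoint s.zeroIdeal ∨
      IsLineWithEmbeddedPoint s.zeroIdeal := by
  obtain ⟨T, hT⟩ := exists_isVectorFieldOf s
  rcases exists_cyclic_basis_or_scalar_add_rank_one finrank_linearForm
    (ne_algebraMap_of_isVectorFieldOf hT hs) with ⟨b, h₀, h₁⟩ | ⟨b, x, c, i, hc, h₀, h₁, h₂⟩
  · rcases points_of_cyclic hT h₀ h₁ with h | h | h
    · exact .inl h
    · exact .inr (.inl h)
    · exact .inr (.inr (.inl h))
  · have hTb (m : Fin 3) : T (b m) = x • b m + (Pi.single 2 c : Fin 3 → k) m • b i := by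
      fin_cases m <;> simp_all
    have hline := line_of_scalar_add_rank_one b hT (l := 2) (by simpa using hc)
      (fun m hm => by simp [hm]) hTb
    exact .inr (.inr (.inr hline))
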